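/- **Setting.** There are $K\ge 1$ arms $i\in\{1,\dots,K\}$; arm $i$ has a reward distribution $\nu_i$ with finite mean $\mu_i\in[0,1]$. Put $\mu_{\max}=\max_j\mu_j$ and $\Delta_i=\mu_{\max}-\mu_i$. At each time $t=1,\dots,n$ ($n\ge1$) a policy pulls an arm $A_t$ and observes only a feedback $Y_t$. Let $\mathcal F_t=\sigma((A_s,Y_s):1\le s\le t)$ and let $T_i(t)$ be the number of pulls of arm $i$ at times $1,\dots,t$. The *bias model* is: $Y_t$ is integrable, $$\mathbb E[Y_t\mid\mathcal F_{t-1}]=\mu_{A_t}\,f\!\left(\frac{T^0_{A_t}+T_{A_t}(t-1)}{t_0+t-1}\right),$$ and $Y_t-\mathbb E[Y_t\mid\mathcal F_{t-1}]$ is conditionally $1$-subgaussian given $\mathcal F_{t-1}$. Here $T^0_i\ge 1$ are real initial biases, $t_0=\sum_iT^0_i$, and $f:(0,1]\to(0,1]$ is non-decreasing and $L$-Lipschitz. Write $T^0_{\max}$, $T^0_{\min}$ for the largest and smallest $T^0_i$. The regret is $\mathrm{Reg}(n)=\max_j\mathbb E\big[\sum_{t\le n}(X_{j,t}-X_{A_t,t})\big]$,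 where the unobserved $X_{i,t}\sim\nu_i$ is independent of $\mathcal F_{t-1}$. **Algorithm.** Phased elimination knows $K$ and $n$, but not $f$, the $T^0_i$ or the $\mu_i$. Put $$m_r=\left\lceil 2^{2r+5}\log\left(\tfrac{12}{\pi^2}K^2r^2n\right)\right\rceil .$$ Start with $\mathcal A_1=\{1,\dots,K\}$. In round $r=1,2,\dots$ pull all arms of $\mathcal A_r$ cyclically in increasing order, $m_r$ times each; let $\hat\mu_i(r)$ be the average feedback of arm $i$ in round $r$; keep $\mathcal A_{r+1}=\{i\in\mathcal A_r:\max_{j\in\mathcal A_r}\hat\mu_j(r)-\hat\mu_i(r)\le2^{-r}\}$. The algorithm is run for $n$ time steps. **Minimal reweightings.** For $S\subseteq\{1,\dots,K\}$ put $b_i(S)=|\{j\in S:j<i\}|$. Define recursively $U_1=\{1,\dots,K\}$ and $U_{r+1}=\{i\in U_r:\Delta_i f^{\min}_i(r)\le 2^{-r+1}\}$, where $$f_i^{\min}(r)=\frac1{m_r}\sum_{\ell=1}^{m_r}f\!\left(\frac{T^0_i+\sum_{r'<r}m_{r'}+\ell-1}{t_0+\sum_{r'<r}|U_{r'}|m_{r'}+|U_r|(\ell-1)+b_i(U_r)}\right),$$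 and let $u_i=\min\{r\ge1:i\notin U_{r+1}\}$. **Theorem.** Suppose that phased elimination is run for $n$ steps under the bias model and that $$\log(nK)\ \ge\ \frac{\mu_{\max}L}{2^5}\left(1+\max\left\{\Big(1+\tfrac{T^0_{\max}-T^0_{\min}}K\Big)\log\!\Big(1+2^8\log\big(\tfrac{12}{\pi^2}K^2n\big)\Big),\ \big(1+T^0_{\max}-T^0_{\min}\big)\log 13\right\}\right).$$ Write $\Lambda=\frac{2^{11}}3\log\left(\frac{12}{\pi^2}K^2n^3\right)$. Then: 1. For every $i$ with $\Delta_i>0$, the round $u_i$ exists, $u_i\ge2$ and $f_i^{\min}(u_i-1)>0$; moreover $$\mathrm{Reg}(n)=\sum_{i:\Delta_i>0}\Delta_i\,\mathbb E[T_i(n)]\le\sum_{i:\Delta_i>0}\left(\Delta_i+\frac{\Lambda}{\Delta_i\,f_i^{\min}(u_i-1)^2}\right).$$ 2. $\displaystyle\mathrm{Reg}(n)\le K+2\sqrt{\frac{nK\Lambda}{f\big(T^0_{\min}/(t_0+K-1)\big)^2}}$. 3. $\displaystyle\mathrm{Reg}(n)\le\sum_{i:\Delta_i>0}\left(\Delta_i+\frac{\Lambda}{\Delta_i\,f\big(\min\{\frac{T^0_i}{t_0+i-1},\frac1K\}\big)^2}\right)\le\sum_{i:\Delta_i>0}\left(\Delta_i+\frac{\Lambda}{\Delta_i\,f\big(\frac{T^0_{\min}}{t_0+K-1}\big)^2}\right)$.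 4. If in addition $T^0_{\max}\le2^7\log\left(\frac{12}{\pi^2}K^2n\right)$, then $$\mathrm{Reg}(n)\le\sum_{i:\Delta_i>0}\left(\Delta_i+\frac{\Lambda}{\Delta_i\,f(\frac1{15K})^2}\right)\quad\text{and}\quad\mathrm{Reg}(n)\le K+2\sqrt{\frac{nK\Lambda}{f(\frac1{15K})^2}}.$$ -/

import Mathlib

open MeasureTheory ProbabilityTheory
open scoped NNReal

noncomputable section

namespace AffinityBandit

variable {K : ℕ}

/-! ### The phased elimination algorithm

Rounds `r`, iterations `ℓ` and times `t` are numbered from `1`.  Arms are the elements of `Fin K`,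
so that arm `i ∈ {1, …, K}` of the usual numbering has `(i : ℕ) + 1` as its index. -/

/-- The (real-valued) sampling schedule `m_r = 2^(2r+5) log (12 K² r² n / π²)`. -/
def schedule (K n r : ℕ) : ℝ :=
  2 ^ (2 * r + 5) * Real.log (12 / Real.pi ^ 2 * (K : ℝ) ^ 2 * (r : ℝ) ^ 2 * (n : ℝ))

/-- The number `⌈m_r⌉` of times that each active arm is pulled in round `r`. -/
def pulls (K n r : ℕ) : ℕ := ⌈schedule K n r⌉₊

/-- `b_i(S)`: the number of arms of `S` that precede `i`. -/
def rankIn (S : Finset (Fin K)) (i : Fin K) : ℕ := (S.filter (fun j => j < i)).card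

/-- If round `r` has active set `S` and begins after `τ` time steps, then the arm `i ∈ S` is pulled
for the `ℓ`-th time in that round at this time. -/
def pullTime (S : Finset (Fin K)) (τ : ℕ) (i : Fin K) (ℓ : ℕ) : ℕ :=
  τ + S.card * (ℓ - 1) + rankIn S i + 1

/-- The empirical average, along the feedback sequence `y`, of the feedback of arm `i ∈ S` during
round `r`, where round `r` has active set `S` and begins after `τ` time steps. -/
def empMean (n : ℕ) (y : ℕ → ℝ) (r : ℕ) (S : Finset (Fin K)) (τ : ℕ) (i : Fin K) : ℝ :=
  (∑ ℓ ∈ Finset.Icc 1 (pulls K n r), y (pullTime S τ i ℓ)) / (pulls K n r : ℝ)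

/-- The pair `(A_r, τ_{r-1})`: the active set of round `r` and the number of time steps before
round `r`, when the algorithm receives the feedback sequence `y` (`r = 0` is a placeholder). -/
def roundState (K n : ℕ) (y : ℕ → ℝ) : ℕ → Finset (Fin K) × ℕ
  | 0 => (Finset.univ, 0)
  | 1 => (Finset.univ, 0)
  | r + 2 =>
    let S := (roundState K n y (r + 1)).1
    let τ := (roundState K n y (r + 1)).2
    (S.filter (fun i => ∀ j ∈ S,
        empMean n y (r + 1) S τ j - empMean n y (r + 1) S τ i ≤ (1 / 2 : ℝ) ^ (r + 1)),
      τ + S.card * pulls K n (r + 1))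

/-- The round that contains the time step `t ≥ 1`: the first `r ≥ 1` with `t ≤ τ_r`. -/
def roundOf (K n : ℕ) (y : ℕ → ℝ) (t : ℕ) : ℕ :=
  sInf {r : ℕ | 1 ≤ r ∧ t ≤ (roundState K n y (r + 1)).2}

/-- The arm that the phased elimination algorithm pulls at time `t ≥ 1`: in each round it cycles
through the active arms in increasing order.  It knows only `K`, `n` and the feedback that it has
received before time `t` (see `elimArm_congr`). -/
def elimArm (n : ℕ) [NeZero K] (y : ℕ → ℝ) (t : ℕ) : Fin K :=
  let s := roundState K n y (roundOf K n y t)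
  (s.1.sort (fun i j => i ≤ j)).getD ((t - 1 - s.2) % s.1.card) 0


theorem pulls_pos [NeZero K] {n r : ℕ} (hn : 1 ≤ n) (hr : 1 ≤ r) : 1 ≤ pulls K n r := by
  have hK : (1 : ℝ) ≤ K := by exact_mod_cast Nat.one_le_iff_ne_zero.2 (NeZero.ne K)
  have hn' : (1 : ℝ) ≤ n := by exact_mod_cast hn
  have hr' : (1 : ℝ) ≤ r := by exact_mod_cast hr
  have hpi : 1 < 12 / Real.pi ^ 2 := by
    rw [one_lt_div (by positivity)]
    nlinarith [Real.pi_lt_d2, Real.pi_pos]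
  have h1 : (1 : ℝ) ≤ (K : ℝ) ^ 2 := one_le_pow₀ hK
  have h2 : (1 : ℝ) ≤ (r : ℝ) ^ 2 := one_le_pow₀ hr'
  have h : 1 < 12 / Real.pi ^ 2 * (K : ℝ) ^ 2 * (r : ℝ) ^ 2 * (n : ℝ) := by
    have h3 : 1 < 12 / Real.pi ^ 2 * (K : ℝ) ^ 2 := by nlinarith
    have h4 : 1 < 12 / Real.pi ^ 2 * (K : ℝ) ^ 2 * (r : ℝ) ^ 2 := by nlinarith
    nlinarith
  exact Nat.one_le_ceil_iff.2 (mul_pos (by positivity) (Real.log_pos h))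

theorem rankIn_lt {S : Finset (Fin K)} {i : Fin K} (hi : i ∈ S) : rankIn S i < S.card :=
  Finset.card_lt_card (Finset.filter_ssubset.2 ⟨i, hi, by simp⟩)

theorem lt_pullTime (S : Finset (Fin K)) (τ : ℕ) (i : Fin K) (ℓ : ℕ) : τ < pullTime S τ i ℓ := by
  unfold pullTime; omega

theorem pullTime_le {S : Finset (Fin K)} {τ : ℕ} {i : Fin K} {ℓ m : ℕ} (hi : i ∈ S)
    (hℓ : ℓ ∈ Finset.Icc 1 m) : pullTime S τ i ℓ ≤ τ + S.card * m := by
  have h := rankIn_lt hi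
  obtain ⟨h1, h2⟩ := Finset.mem_Icc.1 hℓ
  obtain ⟨k, rfl⟩ := Nat.exists_eq_add_of_le h1
  have : S.card * (1 + k) ≤ S.card * m := Nat.mul_le_mul_left _ h2
  have e : S.card * (1 + k) = S.card + S.card * (1 + k - 1) := by
    rw [Nat.add_sub_cancel_left]; ring
  unfold pullTime; omega

theorem sort_getD_rankIn [NeZero K] {S : Finset (Fin K)} {i : Fin K} (hi : i ∈ S) :
    (S.sort (fun a b => a ≤ b)).getD (rankIn S i) 0 = i := by
  have hr : i ∈ Set.range (S.orderEmbOfFin rfl) := by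
    rw [Finset.range_orderEmbOfFin]; exact hi
  obtain ⟨k, hk⟩ := hr
  have hc : rankIn S i = k := by
    have : S.filter (fun j => j < i) =
        (Finset.univ.filter (fun x : Fin S.card => x < k)).map (S.orderEmbOfFin rfl).toEmbedding := by
      ext j
      simp only [Finset.mem_filter, Finset.mem_map, Finset.mem_univ, true_and]
      constructor
      · rintro ⟨hj, hlt⟩
        have : j ∈ Set.range (S.orderEmbOfFin rfl) := by
          rw [Finset.range_orderEmbOfFin]; exact hj
        obtain ⟨x, rfl⟩ := this
        refine ⟨x, ?_, rfl⟩
        rw [← hk] at hlt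
        simpa using hlt
      · rintro ⟨x, hx, rfl⟩
        refine ⟨Finset.orderEmbOfFin_mem S rfl x, ?_⟩
        rw [← hk]
        simpa using hx
    rw [rankIn, this, Finset.card_map]
    rw [show (Finset.univ.filter (fun x : Fin S.card => x < k)) = Finset.Iio k by ext; simp,
      Fin.card_Iio]
  rw [hc, List.getD_eq_getElem _ _ (by simp)]
  rw [← hk, Finset.orderEmbOfFin_apply]
  rfl

theorem roundState_succ_snd (n : ℕ) (y : ℕ → ℝ) {r : ℕ} (hr : 1 ≤ r) :
    (roundState K n y (r + 1)).2 =
      (roundState K n y r).2 + (roundState K n y r).1.card * pulls K n r := by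
  obtain ⟨k, rfl⟩ := Nat.exists_eq_add_of_le' hr
  rfl

theorem roundState_nonempty [NeZero K] (n : ℕ) (y : ℕ → ℝ) (r : ℕ) :
    (roundState K n y r).1.Nonempty := by
  match r with
  | 0 => exact Finset.univ_nonempty
  | 1 => exact Finset.univ_nonempty
  | r + 2 =>
    obtain ⟨i, hi, hmax⟩ := Finset.exists_max_image (roundState K n y (r + 1)).1
      (empMean n y (r + 1) (roundState K n y (r + 1)).1 (roundState K n y (r + 1)).2)
      (roundState_nonempty n y (r + 1))
    refine ⟨i, Finset.mem_filter.2 ⟨hi, fun j hj => ?_⟩⟩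
    have := hmax j hj
    have h2 : (0 : ℝ) < (1 / 2 : ℝ) ^ (r + 1) := by positivity
    linarith

theorem roundState_snd_mono (n : ℕ) (y : ℕ → ℝ) :
    Monotone (fun r => (roundState K n y r).2) := by
  refine monotone_nat_of_le_succ fun r => ?_
  rcases Nat.eq_zero_or_pos r with rfl | hr
  · exact le_rfl
  · change _ ≤ (roundState K n y (r + 1)).2
    rw [roundState_succ_snd n y hr]; exact Nat.le_add_right _ _

theorem le_roundState_snd [NeZero K] {n : ℕ} (hn : 1 ≤ n) (y : ℕ → ℝ) (r : ℕ) :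
    r ≤ (roundState K n y (r + 1)).2 := by
  induction r with
  | zero => exact Nat.zero_le _
  | succ r ih =>
    rw [roundState_succ_snd n y (Nat.le_add_left 1 r)]
    have h1 := pulls_pos (K := K) hn (Nat.le_add_left 1 r)
    have h2 := (roundState_nonempty n y (r + 1) (K := K)).card_pos
    have := Nat.mul_pos h2 h1
    omega

theorem roundOf_spec [NeZero K] {n : ℕ} (hn : 1 ≤ n) (y : ℕ → ℝ) {t : ℕ} (ht : 1 ≤ t) :
    1 ≤ roundOf K n y t ∧ (roundState K n y (roundOf K n y t)).2 < t ∧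
      t ≤ (roundState K n y (roundOf K n y t + 1)).2 := by
  have hne : {r : ℕ | 1 ≤ r ∧ t ≤ (roundState K n y (r + 1)).2}.Nonempty :=
    ⟨t, ht, le_roundState_snd hn y t⟩
  obtain ⟨h1, h2⟩ := Nat.sInf_mem hne
  refine ⟨h1, ?_, h2⟩
  by_contra! hcon
  change 1 ≤ roundOf K n y t at h1
  obtain ⟨k, hk⟩ := Nat.exists_eq_add_of_le' h1
  rw [hk] at hcon
  rcases Nat.eq_zero_or_pos k with rfl | hk0
  · have : (roundState K n y (0 + 1)).2 = 0 := rfl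
    omega
  · have : roundOf K n y t ≤ k := Nat.sInf_le ⟨hk0, hcon⟩
    omega

theorem roundOf_eq [NeZero K] {n : ℕ} (hn : 1 ≤ n) (y : ℕ → ℝ) {t r : ℕ} (hr : 1 ≤ r)
    (h1 : (roundState K n y r).2 < t) (h2 : t ≤ (roundState K n y (r + 1)).2) :
    roundOf K n y t = r := by
  obtain ⟨g1, g2, g3⟩ := roundOf_spec (K := K) hn y (t := t) (by omega)
  refine le_antisymm (Nat.sInf_le ⟨hr, h2⟩) ?_
  by_contra! hlt
  have := roundState_snd_mono (K := K) n y (show roundOf K n y t + 1 ≤ r from hlt)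
  simp only at this
  omega

/-- In each round the algorithm pulls the active arms in increasing order, `⌈m_r⌉` times. -/
theorem elimArm_pullTime [NeZero K] {n : ℕ} (hn : 1 ≤ n) (y : ℕ → ℝ) {r ℓ : ℕ} {i : Fin K}
    (hr : 1 ≤ r) (hi : i ∈ (roundState K n y r).1) (hℓ : ℓ ∈ Finset.Icc 1 (pulls K n r)) :
    elimArm n y (pullTime (roundState K n y r).1 (roundState K n y r).2 i ℓ) = i := by
  have h := roundOf_eq hn y hr (lt_pullTime (roundState K n y r).1 (roundState K n y r).2 i ℓ)
    (by rw [roundState_succ_snd n y hr]; exact pullTime_le hi hℓ)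
  unfold elimArm
  simp only [h]
  have hm : (pullTime (roundState K n y r).1 (roundState K n y r).2 i ℓ - 1 -
      (roundState K n y r).2) % (roundState K n y r).1.card = rankIn (roundState K n y r).1 i := by
    have : pullTime (roundState K n y r).1 (roundState K n y r).2 i ℓ - 1 -
      (roundState K n y r).2 = rankIn (roundState K n y r).1 i +
        (roundState K n y r).1.card * (ℓ - 1) := by unfold pullTime; omega
    rw [this, Nat.add_mul_mod_self_left, Nat.mod_eq_of_lt (rankIn_lt hi)]
  rw [hm]
  exact sort_getD_rankIn hi

theorem roundState_congr (K : ℕ) {n : ℕ} {y y' : ℕ → ℝ} (r : ℕ)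
    (h : ∀ s, s ≤ (roundState K n y r).2 → y s = y' s) :
    roundState K n y r = roundState K n y' r := by
  match r with
  | 0 => rfl
  | 1 => rfl
  | r + 2 =>
    have hs := roundState_succ_snd (K := K) n y (Nat.le_add_left 1 r)
    have ih := roundState_congr K (n := n) (y := y) (y' := y') (r + 1)
      (fun s hle => h s (hle.trans (hs ▸ Nat.le_add_right _ _)))
    have he : ∀ j ∈ (roundState K n y (r + 1)).1,
        empMean n y (r + 1) (roundState K n y (r + 1)).1 (roundState K n y (r + 1)).2 j =
        empMean n y' (r + 1) (roundState K n y (r + 1)).1 (roundState K n y (r + 1)).2 j := by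
      intro j hj
      unfold empMean
      congr 1
      refine Finset.sum_congr rfl fun ℓ hℓ => h _ ?_
      rw [hs]
      exact pullTime_le hj hℓ
    simp only [roundState]
    rw [← ih]
    refine Prod.ext (Finset.filter_congr fun i hi => ?_) rfl
    refine forall₂_congr fun j hj => ?_
    rw [he i hi, he j hj]

/-- The arm pulled at time `t` depends only on the feedback received before time `t`. -/
theorem elimArm_congr [NeZero K] {n : ℕ} (hn : 1 ≤ n) {y y' : ℕ → ℝ} {t : ℕ} (ht : 1 ≤ t)
    (h : ∀ s, s < t → y s = y' s) : (elimArm n y t : Fin K) = elimArm n y' t := by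
  obtain ⟨g1, g2, g3⟩ := roundOf_spec (K := K) hn y ht
  have hst := roundState_congr K (n := n) (y := y) (y' := y') (roundOf K n y t)
    (fun s hs => h s (lt_of_le_of_lt hs g2))
  have : roundOf K n y' t = roundOf K n y t := by
    refine roundOf_eq (K := K) hn y' g1 (hst ▸ g2) ?_
    rw [roundState_succ_snd (K := K) n y' g1, ← hst, ← roundState_succ_snd (K := K) n y g1]
    exact g3
  unfold elimArm
  simp only [this, hst]

/-! ### The environment -/

/-- The number of times that arm `i` is pulled from time `1` to time `t`. -/
def playCount (A : ℕ → Fin K) (i : Fin K) (t : ℕ) : ℕ :=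
  ((Finset.Icc 1 t).filter (fun s => A s = i)).card

/-- `t₀ = ∑ i, T⁰_i`. -/
def totalInit (T0 : Fin K → ℝ) : ℝ := ∑ i, T0 i

/-- The fraction `(T⁰_i + T_i(t-1)) / (t₀ + t - 1)`. -/
def fraction (T0 : Fin K → ℝ) (A : ℕ → Fin K) (i : Fin K) (t : ℕ) : ℝ :=
  (T0 i + (playCount A i (t - 1) : ℝ)) / (totalInit T0 + ((t : ℝ) - 1))

/-- The σ-algebra `F_t` generated by the observations `(A_s, Y_s)`, `1 ≤ s ≤ t`. -/
@[reducible] def history {Ω : Type*} (A : ℕ → Ω → Fin K) (Y : ℕ → Ω → ℝ) (t : ℕ) : MeasurableSpace Ω :=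
  ⨆ s ∈ Finset.Icc 1 t, MeasurableSpace.comap (fun ω => (A s ω, Y s ω)) inferInstance

/-- The feedback model up to time `n`: given the past, the feedback `Y_t` has conditional mean
`μ_{A_t} f((T⁰_{A_t} + T_{A_t}(t-1)) / (t₀ + t - 1))`, and its deviation from its conditional mean
is conditionally `1`-subgaussian. -/
structure IsBiasedFeedback {Ω : Type*} [MeasurableSpace Ω] (P : Measure Ω) (n : ℕ)
    (μ : Fin K → ℝ) (f : ℝ → ℝ) (T0 : Fin K → ℝ)
    (A : ℕ → Ω → Fin K) (Y : ℕ → Ω → ℝ) : Prop where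
  measurable : ∀ t ∈ Finset.Icc 1 n, Measurable (Y t)
  integrable : ∀ t ∈ Finset.Icc 1 n, Integrable (Y t) P
  condExp_eq : ∀ t ∈ Finset.Icc 1 n,
    P[Y t | history A Y (t - 1)] =ᵐ[P]
      fun ω => μ (A t ω) * f (fraction T0 (fun s => A s ω) (A t ω) t)
  subgaussian : ∀ t ∈ Finset.Icc 1 n, ∀ c : ℝ,
    Integrable (fun ω => Real.exp (c * (Y t ω - (P[Y t | history A Y (t - 1)]) ω))) P ∧
    P[fun ω => Real.exp (c * (Y t ω - (P[Y t | history A Y (t - 1)]) ω)) | history A Y (t - 1)]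
      ≤ᵐ[P] fun _ => Real.exp (c ^ 2 / 2)

/-- The (unobserved) real rewards up to time `n`: `X t i` is a sample from the distribution `ν i`
of arm `i` that is independent of what was observed before time `t`. -/
structure IsRealReward {Ω : Type*} [MeasurableSpace Ω] (P : Measure Ω) (n : ℕ)
    (ν : Fin K → Measure ℝ) (A : ℕ → Ω → Fin K) (Y : ℕ → Ω → ℝ)
    (X : ℕ → Fin K → Ω → ℝ) : Prop where
  measurable : ∀ t ∈ Finset.Icc 1 n, ∀ i, Measurable (X t i)
  law : ∀ t ∈ Finset.Icc 1 n, ∀ i, P.map (X t i) = ν i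
  indep : ∀ t ∈ Finset.Icc 1 n, ∀ i,
    Indep (MeasurableSpace.comap (X t i) inferInstance) (history A Y (t - 1)) P

/-- The mean of the distribution of arm `i`. -/
def armMean (ν : Fin K → Measure ℝ) (i : Fin K) : ℝ := ∫ x, x ∂(ν i)

/-- The suboptimality gap `Δ_i = max_j μ_j - μ_i`. -/
def gap (μ : Fin K → ℝ) (i : Fin K) : ℝ := (⨆ j, μ j) - μ i

/-- The regret `max_j E[∑_{t ≤ n} (X_{j,t} - X_{A_t,t})]`. -/
def regret {Ω : Type*} [MeasurableSpace Ω] (P : Measure Ω) (n : ℕ)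
    (A : ℕ → Ω → Fin K) (X : ℕ → Fin K → Ω → ℝ) : ℝ :=
  ⨆ j : Fin K, ∫ ω, ∑ t ∈ Finset.Icc 1 n, (X t j ω - X t (A t ω) ω) ∂P

/-! ### The reweightings `f^min_i(r)` and the rounds `u_i` -/

/-- The average reweighting of arm `i` during round `r`, if round `r` has active set `S` and the
rounds before it took `τ` time steps in total. -/
def avgReweight (n : ℕ) (f : ℝ → ℝ) (T0 : Fin K → ℝ) (r : ℕ) (S : Finset (Fin K)) (τ : ℕ)
    (i : Fin K) : ℝ :=
  (∑ ℓ ∈ Finset.Icc 1 (pulls K n r),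
    f ((T0 i + ∑ r' ∈ Finset.Ico 1 r, (pulls K n r' : ℝ) + ((ℓ : ℝ) - 1)) /
      (totalInit T0 + (τ : ℝ) + (S.card : ℝ) * ((ℓ : ℝ) - 1) + (rankIn S i : ℝ))))
    / (pulls K n r : ℝ)

/-- The pair `(U_r, ∑_{r' < r} |U_{r'}| m_{r'})`, where `U_1` is the set of all arms and
`U_{r+1} = {i ∈ U_r | Δ_i f^min_i(r) ≤ 2^(-r+1)}` (`r = 0` is a placeholder). -/
def idealState (n : ℕ) (μ : Fin K → ℝ) (f : ℝ → ℝ) (T0 : Fin K → ℝ) :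
    ℕ → Finset (Fin K) × ℕ
  | 0 => (Finset.univ, 0)
  | 1 => (Finset.univ, 0)
  | r + 2 =>
    let S := (idealState n μ f T0 (r + 1)).1
    let τ := (idealState n μ f T0 (r + 1)).2
    (S.filter (fun i => gap μ i * avgReweight n f T0 (r + 1) S τ i ≤ 2 * (1 / 2 : ℝ) ^ (r + 1)),
      τ + S.card * pulls K n (r + 1))

/-- The set `U_r`. -/
def idealSet (n : ℕ) (μ : Fin K → ℝ) (f : ℝ → ℝ) (T0 : Fin K → ℝ) (r : ℕ) : Finset (Fin K) :=
  (idealState n μ f T0 r).1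

/-- `f^min_i(r)`: the average reweighting of arm `i` during round `r` if the active sets of the
rounds `1, …, r` were `U_1, …, U_r`. -/
def fMin (n : ℕ) (μ : Fin K → ℝ) (f : ℝ → ℝ) (T0 : Fin K → ℝ) (i : Fin K) (r : ℕ) : ℝ :=
  avgReweight n f T0 r (idealState n μ f T0 r).1 (idealState n μ f T0 r).2 i

/-- `u_i = min {r ≥ 1 | i ∉ U_{r+1}}`. -/
def lastRound (n : ℕ) (μ : Fin K → ℝ) (f : ℝ → ℝ) (T0 : Fin K → ℝ) (i : Fin K) : ℕ :=
  sInf {r : ℕ | 1 ≤ r ∧ i ∉ idealSet n μ f T0 (r + 1)}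

/-! ### The bounds -/

/-- `(2^11 / 3) log (12 K² n³ / π²)`. -/
def logFactor (K n : ℕ) : ℝ :=
  2 ^ 11 / 3 * Real.log (12 / Real.pi ^ 2 * (K : ℝ) ^ 2 * (n : ℝ) ^ 3)

/-- `∑_{i : Δ_i > 0} (Δ_i + (2^11 / 3) log (12 K² n³ / π²) / (Δ_i w_i²))`. -/
def instanceBound (n : ℕ) (μ : Fin K → ℝ) (w : Fin K → ℝ) : ℝ :=
  ∑ i with 0 < gap μ i, (gap μ i + logFactor K n * (1 / (gap μ i * w i ^ 2)))

/-- `K + 2 √((2^11 / 3) n K log (12 K² n³ / π²) / w²)`. -/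
def gapFreeBound (K n : ℕ) (w : ℝ) : ℝ :=
  (K : ℝ) + 2 * Real.sqrt ((n : ℝ) * (K : ℝ) * logFactor K n / w ^ 2)

end AffinityBandit

end

/-!
Call a run *good* if, in every round `r` completed within the horizon and for every arm `j` active
in it, the noise in the empirical mean of `j` and the noise in that of a fixed best arm `a` differ
by at most `2^(-r-1)` (`NoiseSmall`).

On a good run the bias does no harm, since only differences of empirical means are compared. All
arms that are active in round `r` have been pulled equally often, so the fractions at which `f` is
evaluated for two of them differ at the `ℓ`-th pull only by a multiple of `1 / (N + ℓ)`, where `N`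
is the number of earlier pulls. Summed over the round this is logarithmic in the first round and
bounded afterwards, because no round is much longer than its predecessors
(`sum_abs_roundFraction_sub_le`). The assumption on the horizon makes `μ_max` times the
difference of the average reweightings at most `2^(-r-1)` (`mul_avgReweight_sub_le`). Hence `a`
survives every round. An arm that is kept satisfies `Δ_i F_i(r) ≤ 2^(-r+1)`, where `F_i(r)` is its
actual average reweighting; as this can only grow when fewer arms are active
(`avgReweight_anti`), the active sets are contained in the sets `U_r` by induction
(`best_mem_and_subset_idealSet`). Arm `i` is therefore pulled in the rounds `1, …, u_i` only, which
amounts to at most `4^(u_i) / 16 * Λ` pulls (`pullsBefore_succ_le_of_le`), and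
`Δ_i f_i^min(u_i - 1) ≤ 2^(2 - u_i)` turns this into `Λ / (Δ_i f_i^min(u_i - 1))²`.

For the probability of a bad run, fix a round, an arm `j` and a sign. The difference of the two sums
of noises is a predictable transform of the conditionally subgaussian increments, with at most
`2 m_r` nonzero weights `±1`; the algorithm being non-anticipating
(`measurable_comp_roundState_roundOf`), the exponential supermartingale gives the tail bound
`exp (-m_r 2^(-2r-4)) ≤ (K² n)⁻²`. The union over at most `n` rounds, `K` arms and two signs costs
at most `1 / n`, that is, at most one additional expected pull per arm.

The other bounds follow from lower bounds on `f_i^min`, and from the usual splitting of the arms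
into those of small and of large gap (`sum_mul_le_gapFree`). For moderate initial biases `f_i^min(1)`
need not be comparable with `f(1 / (15 K))`, but an arm with `u_i = 2` needs no lower bound: it is
pulled at most `Λ ≤ Λ / (Δ_i w)²` times whenever `w ≤ 1`.
-/

noncomputable section

namespace AffinityBandit

/-! ### Combinatorics of the elimination schedule -/

/-- The number of pulls of an arm that is active in all rounds before round `r`. -/
def pullsBefore (K n r : ℕ) : ℕ := ∑ r' ∈ Finset.Ico 1 r, pulls K n r'

theorem pullsBefore_succ (K n : ℕ) {r : ℕ} (hr : 1 ≤ r) :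
    pullsBefore K n (r + 1) = pullsBefore K n r + pulls K n r :=
  Finset.sum_Ico_succ_top hr _

theorem pullsBefore_one (K n : ℕ) : pullsBefore K n 1 = 0 := by simp [pullsBefore]

theorem pulls_one_le_pullsBefore (K n : ℕ) {r : ℕ} (hr : 2 ≤ r) :
    pulls K n 1 ≤ pullsBefore K n r :=
  Finset.single_le_sum (f := pulls K n) (fun _ _ => Nat.zero_le _)
    (Finset.mem_Ico.2 ⟨le_rfl, hr⟩)

section

variable {K : ℕ}

theorem roundState_one (n : ℕ) (y : ℕ → ℝ) : roundState K n y 1 = (Finset.univ, 0) := rfl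

theorem roundState_succ_fst (n : ℕ) (y : ℕ → ℝ) {r : ℕ} (hr : 1 ≤ r) :
    (roundState K n y (r + 1)).1 = (roundState K n y r).1.filter (fun i =>
      ∀ j ∈ (roundState K n y r).1,
        empMean n y r (roundState K n y r).1 (roundState K n y r).2 j -
          empMean n y r (roundState K n y r).1 (roundState K n y r).2 i ≤ (1 / 2 : ℝ) ^ r) := by
  obtain ⟨k, rfl⟩ := Nat.exists_eq_add_of_le' hr
  rfl

theorem roundState_fst_subset (n : ℕ) (y : ℕ → ℝ) {r : ℕ} (hr : 1 ≤ r) :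
    (roundState K n y (r + 1)).1 ⊆ (roundState K n y r).1 := by
  rw [roundState_succ_fst n y hr]
  exact Finset.filter_subset _ _

/-- The rounds before round `r` take at least as long as if only the arms that are still active in
round `r` had been pulled in them. -/
theorem card_mul_pullsBefore_le (n : ℕ) (y : ℕ → ℝ) {r : ℕ} (hr : 1 ≤ r) :
    (roundState K n y r).1.card * pullsBefore K n r ≤ (roundState K n y r).2 := by
  induction r, hr using Nat.le_induction with
  | base => simp [pullsBefore_one]
  | succ r hr ih =>
    have h := Finset.card_le_card (roundState_fst_subset (K := K) n y hr)
    rw [pullsBefore_succ K n hr, roundState_succ_snd n y hr, mul_add]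
    exact add_le_add ((Nat.mul_le_mul_right _ h).trans ih) (Nat.mul_le_mul_right _ h)

theorem rankIn_mono {S U : Finset (Fin K)} (h : S ⊆ U) (i : Fin K) : rankIn S i ≤ rankIn U i :=
  Finset.card_le_card (Finset.filter_subset_filter _ h)

theorem rankIn_le_val (S : Finset (Fin K)) (i : Fin K) : rankIn S i ≤ (i : ℕ) := by
  calc rankIn S i ≤ rankIn Finset.univ i := rankIn_mono (Finset.subset_univ _) i
    _ = (Finset.Iio i).card := by
        unfold rankIn; congr 1; ext; simp
    _ = i := Fin.card_Iio i

theorem exists_rankIn_eq {S : Finset (Fin K)} {b : ℕ} (hb : b < S.card) :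
    ∃ i ∈ S, rankIn S i = b := by
  have hinj : Set.InjOn (rankIn S) S := by
    have key : ∀ i ∈ S, ∀ j ∈ S, i < j → rankIn S i < rankIn S j := by
      intro i hi j _ hij
      refine Finset.card_lt_card (Finset.ssubset_iff_of_subset ?_ |>.2 ⟨i, ?_, ?_⟩)
      · intro x hx
        simp only [Finset.mem_filter] at hx ⊢
        exact ⟨hx.1, hx.2.trans hij⟩
      · simp [hi, hij]
      · simp
    intro i hi j hj h
    rcases lt_trichotomy i j with h' | h' | h'
    · exact absurd h (key i hi j hj h').ne
    · exact h'
    · exact absurd h (key j hj i hi h').ne'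
  have himg : S.image (rankIn S) = Finset.range S.card := by
    refine Finset.eq_of_subset_of_card_le ?_ ?_
    · intro b hb
      obtain ⟨i, hi, rfl⟩ := Finset.mem_image.1 hb
      exact Finset.mem_range.2 (rankIn_lt hi)
    · rw [Finset.card_range, Finset.card_image_of_injOn hinj]
  have := himg.symm ▸ Finset.mem_range.2 hb
  simpa using this

theorem exists_pullTime_eq {S : Finset (Fin K)} {τ t m : ℕ} (h1 : τ < t)
    (h2 : t ≤ τ + S.card * m) : ∃ i ∈ S, ∃ ℓ ∈ Finset.Icc 1 m, t = pullTime S τ i ℓ := by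
  obtain ⟨q, rfl⟩ := Nat.exists_eq_add_of_lt h1
  have hq : q < S.card * m := by omega
  have hS : 0 < S.card := Nat.pos_of_ne_zero (by rintro h; simp [h] at hq)
  obtain ⟨i, hi, hb⟩ := exists_rankIn_eq (Nat.mod_lt q hS)
  refine ⟨i, hi, q / S.card + 1, Finset.mem_Icc.2 ⟨Nat.le_add_left _ _, ?_⟩, ?_⟩
  · exact Nat.div_lt_of_lt_mul hq
  · have := Nat.div_add_mod q S.card
    unfold pullTime
    rw [hb, Nat.add_sub_cancel]
    omega

theorem pullTime_strictMonoOn {S : Finset (Fin K)} (τ : ℕ) {i : Fin K} (hi : i ∈ S) {k ℓ : ℕ}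
    (hk : 1 ≤ k) (hkl : k < ℓ) : pullTime S τ i k < pullTime S τ i ℓ := by
  have hS : 0 < S.card := Finset.card_pos.2 ⟨i, hi⟩
  have : S.card * (k - 1) < S.card * (ℓ - 1) := Nat.mul_lt_mul_of_pos_left (by omega) hS
  unfold pullTime; omega

theorem pullTime_injOn {S : Finset (Fin K)} (τ : ℕ) {i : Fin K} (hi : i ∈ S) (m : ℕ) :
    Set.InjOn (pullTime S τ i) (Finset.Icc 1 m) := by
  intro k hk ℓ hℓ h
  simp only [Finset.coe_Icc, Set.mem_Icc] at hk hℓ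
  rcases lt_trichotomy k ℓ with h' | h' | h'
  · exact absurd h (pullTime_strictMonoOn τ hi hk.1 h').ne
  · exact h'
  · exact absurd h (pullTime_strictMonoOn τ hi hℓ.1 h').ne'

/-- The times of round `r` at which arm `i` is pulled. -/
theorem elimArm_eq_iff [NeZero K] {n : ℕ} (hn : 1 ≤ n) (y : ℕ → ℝ) {r t : ℕ} (hr : 1 ≤ r)
    (h1 : (roundState K n y r).2 < t) (h2 : t ≤ (roundState K n y (r + 1)).2) (i : Fin K) :
    elimArm n y t = i ↔ i ∈ (roundState K n y r).1 ∧ ∃ ℓ ∈ Finset.Icc 1 (pulls K n r),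
      t = pullTime (roundState K n y r).1 (roundState K n y r).2 i ℓ := by
  constructor
  · rintro rfl
    rw [roundState_succ_snd n y hr] at h2
    obtain ⟨i, hi, ℓ, hℓ, rfl⟩ := exists_pullTime_eq h1 h2
    rw [elimArm_pullTime hn y hr hi hℓ]
    exact ⟨hi, ℓ, hℓ, rfl⟩
  · rintro ⟨hi, ℓ, hℓ, rfl⟩
    exact elimArm_pullTime hn y hr hi hℓ

theorem filter_round_eq_image [NeZero K] {n : ℕ} (hn : 1 ≤ n) (y : ℕ → ℝ) {r : ℕ} (hr : 1 ≤ r)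
    {i : Fin K} (hi : i ∈ (roundState K n y r).1) {T : ℕ}
    (hT : (roundState K n y (r + 1)).2 ≤ T) :
    (Finset.Icc 1 T).filter (fun t => roundOf K n y t = r ∧ elimArm n y t = i) =
      (Finset.Icc 1 (pulls K n r)).image
        (pullTime (roundState K n y r).1 (roundState K n y r).2 i) := by
  ext t
  simp only [Finset.mem_filter, Finset.mem_image]
  constructor
  · rintro ⟨ht, hrt, hit⟩
    obtain ⟨_, g2, g3⟩ := roundOf_spec hn y (Finset.mem_Icc.1 ht).1 (K := K)
    rw [hrt] at g2 g3
    obtain ⟨_, ℓ, hℓ, h⟩ := (elimArm_eq_iff hn y hr g2 g3 i).1 hit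
    exact ⟨ℓ, hℓ, h.symm⟩
  · rintro ⟨ℓ, hℓ, rfl⟩
    have g1 := lt_pullTime (roundState K n y r).1 (roundState K n y r).2 i ℓ
    have g2 := pullTime_le (τ := (roundState K n y r).2) hi hℓ
    rw [← roundState_succ_snd n y hr] at g2
    exact ⟨Finset.mem_Icc.2 ⟨by omega, by omega⟩, roundOf_eq hn y hr g1 g2,
      elimArm_pullTime hn y hr hi hℓ⟩

theorem playCount_eq_add (A : ℕ → Fin K) (i : Fin K) {τ T : ℕ} (h : τ ≤ T) :
    playCount A i T = playCount A i τ + ((Finset.Ioc τ T).filter (fun s => A s = i)).card := by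
  unfold playCount
  rw [← Finset.card_union_of_disjoint]
  · rw [← Finset.filter_union]
    congr 2
    ext s; simp only [Finset.mem_Icc, Finset.mem_union, Finset.mem_Ioc]; omega
  · refine Finset.disjoint_filter_filter ?_
    rw [Finset.disjoint_left]
    intro s; simp only [Finset.mem_Icc, Finset.mem_Ioc]; omega

theorem playCount_mono (A : ℕ → Fin K) (i : Fin K) : Monotone (playCount A i) := by
  intro s t h
  rw [playCount_eq_add A i h]; exact Nat.le_add_right _ _

theorem playCount_le (A : ℕ → Fin K) (i : Fin K) (t : ℕ) : playCount A i t ≤ t :=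
  (Finset.card_filter_le _ _).trans (by simp)

/-- The number of pulls of arm `i` within a round that has been run up to time `T`. -/
theorem card_filter_round [NeZero K] {n : ℕ} (hn : 1 ≤ n) (y : ℕ → ℝ) {r : ℕ} (hr : 1 ≤ r)
    {i : Fin K} (hi : i ∈ (roundState K n y r).1) {T q : ℕ} (hq : q ≤ pulls K n r)
    (hT : T ≤ (roundState K n y (r + 1)).2)
    (h : ∀ ℓ ∈ Finset.Icc 1 (pulls K n r),
      pullTime (roundState K n y r).1 (roundState K n y r).2 i ℓ ≤ T ↔ ℓ ≤ q) :
    ((Finset.Ioc (roundState K n y r).2 T).filter (fun s => elimArm n y s = i)).card = q := by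
  have : (Finset.Ioc (roundState K n y r).2 T).filter (fun s => elimArm n y s = i) =
      (Finset.Icc 1 q).image (pullTime (roundState K n y r).1 (roundState K n y r).2 i) := by
    ext t
    simp only [Finset.mem_filter, Finset.mem_image, Finset.mem_Ioc]
    constructor
    · rintro ⟨⟨h1, h2⟩, hit⟩
      obtain ⟨_, ℓ, hℓ, rfl⟩ := (elimArm_eq_iff hn y hr h1 (h2.trans hT) i).1 hit
      exact ⟨ℓ, Finset.mem_Icc.2 ⟨(Finset.mem_Icc.1 hℓ).1, (h ℓ hℓ).1 h2⟩, rfl⟩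
    · rintro ⟨ℓ, hℓ, rfl⟩
      have hℓ' : ℓ ∈ Finset.Icc 1 (pulls K n r) := by
        simp only [Finset.mem_Icc] at hℓ ⊢; omega
      exact ⟨⟨lt_pullTime _ _ _ _, (h ℓ hℓ').2 (Finset.mem_Icc.1 hℓ).2⟩,
        elimArm_pullTime hn y hr hi hℓ'⟩
  rw [this, Finset.card_image_of_injOn (pullTime_injOn _ hi q), Nat.card_Icc, Nat.add_sub_cancel]

theorem playCount_roundState_succ [NeZero K] {n : ℕ} (hn : 1 ≤ n) (y : ℕ → ℝ) {r : ℕ}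
    (hr : 1 ≤ r) (i : Fin K) :
    playCount (fun t => elimArm n y t) i (roundState K n y (r + 1)).2 =
      playCount (fun t => elimArm n y t) i (roundState K n y r).2 +
        if i ∈ (roundState K n y r).1 then pulls K n r else 0 := by
  rw [playCount_eq_add _ _ (roundState_snd_mono (K := K) n y (Nat.le_succ r))]
  congr 1
  split_ifs with hi
  · refine card_filter_round hn y hr hi le_rfl le_rfl fun ℓ hℓ => ?_
    have := pullTime_le (τ := (roundState K n y r).2) hi hℓ
    rw [← roundState_succ_snd n y hr] at this
    exact iff_of_true this (Finset.mem_Icc.1 hℓ).2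
  · rw [Finset.card_eq_zero, Finset.filter_eq_empty_iff]
    intro t ht hit
    obtain ⟨h1, h2⟩ := Finset.mem_Ioc.1 ht
    exact hi ((elimArm_eq_iff hn y hr h1 h2 i).1 hit).1

theorem playCount_roundState [NeZero K] {n : ℕ} (hn : 1 ≤ n) (y : ℕ → ℝ) {r : ℕ}
    (hr : 1 ≤ r) (i : Fin K) :
    playCount (fun t => elimArm n y t) i (roundState K n y r).2 =
      ∑ r' ∈ Finset.Ico 1 r, if i ∈ (roundState K n y r').1 then pulls K n r' else 0 := by
  induction r, hr using Nat.le_induction with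
  | base => simp [playCount, roundState_one]
  | succ r hr ih => rw [playCount_roundState_succ hn y hr, ih, Finset.sum_Ico_succ_top hr]

theorem roundState_fst_antitone (n : ℕ) (y : ℕ → ℝ) {r s : ℕ} (hr : 1 ≤ r) (h : r ≤ s) :
    (roundState K n y s).1 ⊆ (roundState K n y r).1 := by
  induction s, h using Nat.le_induction with
  | base => exact subset_rfl
  | succ s hs ih => exact (roundState_fst_subset n y (hr.trans hs)).trans ih

theorem playCount_pullTime [NeZero K] {n : ℕ} (hn : 1 ≤ n) (y : ℕ → ℝ) {r ℓ : ℕ}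
    (hr : 1 ≤ r) {i : Fin K} (hi : i ∈ (roundState K n y r).1)
    (hℓ : ℓ ∈ Finset.Icc 1 (pulls K n r)) :
    playCount (fun t => elimArm n y t) i
      (pullTime (roundState K n y r).1 (roundState K n y r).2 i ℓ - 1) =
      pullsBefore K n r + (ℓ - 1) := by
  have h0 := lt_pullTime (roundState K n y r).1 (roundState K n y r).2 i ℓ
  have h2 := pullTime_le (τ := (roundState K n y r).2) hi hℓ
  rw [← roundState_succ_snd n y hr] at h2
  obtain ⟨hl1, hl2⟩ := Finset.mem_Icc.1 hℓ
  rw [playCount_eq_add _ _ (Nat.le_sub_one_of_lt h0), playCount_roundState hn y hr]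
  congr 1
  · refine Finset.sum_congr rfl fun r' hr' => if_pos ?_
    obtain ⟨h3, h4⟩ := Finset.mem_Ico.1 hr'
    exact roundState_fst_antitone n y h3 h4.le hi
  · refine card_filter_round hn y hr hi (by omega) (by omega) fun k hk => ?_
    constructor
    · intro h
      by_contra! hlt
      rcases eq_or_lt_of_le (show ℓ ≤ k by omega) with rfl | h'
      · omega
      · have := pullTime_strictMonoOn (roundState K n y r).2 hi hl1 h'
        omega
    · intro h
      have := pullTime_strictMonoOn (roundState K n y r).2 hi (Finset.mem_Icc.1 hk).1
        (show k < ℓ by omega)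
      omega

/-- At the `ℓ`-th pull of arm `i` in round `r`, the true fraction is the one that enters the average
reweighting of the arm. -/
theorem fraction_pullTime [NeZero K] {n : ℕ} (hn : 1 ≤ n) (T0 : Fin K → ℝ) (y : ℕ → ℝ) {r ℓ : ℕ}
    (hr : 1 ≤ r) {i : Fin K} (hi : i ∈ (roundState K n y r).1)
    (hℓ : ℓ ∈ Finset.Icc 1 (pulls K n r)) :
    fraction T0 (fun t => elimArm n y t) i
      (pullTime (roundState K n y r).1 (roundState K n y r).2 i ℓ) =
    (T0 i + ∑ r' ∈ Finset.Ico 1 r, (pulls K n r' : ℝ) + ((ℓ : ℝ) - 1)) /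
      (totalInit T0 + ((roundState K n y r).2 : ℝ) +
        ((roundState K n y r).1.card : ℝ) * ((ℓ : ℝ) - 1) +
          (rankIn (roundState K n y r).1 i : ℝ)) := by
  obtain ⟨hl1, hl2⟩ := Finset.mem_Icc.1 hℓ
  unfold fraction
  rw [playCount_pullTime hn y hr hi hℓ]
  unfold pullTime pullsBefore
  push_cast [Nat.cast_sub hl1]
  congr 1 <;> ring

end

/-! ### The lengths of the rounds -/

section

variable {K n : ℕ}

theorem one_lt_twelve_div_pi_sq : 1 < 12 / Real.pi ^ 2 := by
  rw [one_lt_div (by positivity)]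
  nlinarith [Real.pi_lt_d2, Real.pi_pos]

theorem sq_mul_le_logArg {r : ℕ} (hr : 1 ≤ r) :
    (K : ℝ) ^ 2 * n ≤ 12 / Real.pi ^ 2 * (K : ℝ) ^ 2 * (r : ℝ) ^ 2 * (n : ℝ) := by
  have hr' : (1 : ℝ) ≤ (r : ℝ) ^ 2 := one_le_pow₀ (by exact_mod_cast hr)
  have h : 1 ≤ 12 / Real.pi ^ 2 * (r : ℝ) ^ 2 := by
    nlinarith [one_lt_twelve_div_pi_sq]
  calc (K : ℝ) ^ 2 * n = 1 * ((K : ℝ) ^ 2 * n) := (one_mul _).symm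
    _ ≤ 12 / Real.pi ^ 2 * (r : ℝ) ^ 2 * ((K : ℝ) ^ 2 * n) := by gcongr
    _ = _ := by ring

theorem log_sq_mul_le {r : ℕ} (hK : 2 ≤ K) (hn : 1 ≤ n) (hr : 1 ≤ r) :
    Real.log ((K : ℝ) ^ 2 * n) ≤
      Real.log (12 / Real.pi ^ 2 * (K : ℝ) ^ 2 * (r : ℝ) ^ 2 * (n : ℝ)) := by
  have hK' : (0 : ℝ) < K := by exact_mod_cast (by omega : 0 < K)
  have hn' : (0 : ℝ) < n := by exact_mod_cast hn
  exact Real.log_le_log (by positivity) (sq_mul_le_logArg hr)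

theorem log_four_le {x : ℝ} (hx : 4 ≤ x) : 1.38 ≤ Real.log x := by
  have h4 : Real.log 4 = 2 * Real.log 2 := by
    rw [show (4 : ℝ) = 2 ^ 2 by norm_num, Real.log_pow]; norm_num
  have := Real.log_le_log (by norm_num) hx
  linarith [Real.log_two_gt_d9]

theorem four_le_sq_mul (hK : 2 ≤ K) (hn : 1 ≤ n) : (4 : ℝ) ≤ (K : ℝ) ^ 2 * n := by
  have hK' : (2 : ℝ) ≤ K := by exact_mod_cast hK
  have hn' : (1 : ℝ) ≤ n := by exact_mod_cast hn
  nlinarith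

theorem schedule_le_pulls (K n r : ℕ) : schedule K n r ≤ pulls K n r := Nat.le_ceil _

theorem schedule_nonneg (hK : 2 ≤ K) (hn : 1 ≤ n) {r : ℕ} (hr : 1 ≤ r) :
    0 ≤ schedule K n r := by
  have := log_four_le ((four_le_sq_mul hK hn).trans (sq_mul_le_logArg hr))
  unfold schedule
  exact mul_nonneg (by positivity) (by linarith)

theorem pulls_le_schedule_add_one (hK : 2 ≤ K) (hn : 1 ≤ n) {r : ℕ} (hr : 1 ≤ r) :
    (pulls K n r : ℝ) ≤ schedule K n r + 1 :=
  (Nat.ceil_lt_add_one (schedule_nonneg hK hn hr)).le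

theorem two_pow_mul_log_le_pulls (hK : 2 ≤ K) (hn : 1 ≤ n) {r : ℕ} (hr : 1 ≤ r) :
    2 ^ (2 * r + 5) * Real.log ((K : ℝ) ^ 2 * n) ≤ pulls K n r :=
  (mul_le_mul_of_nonneg_left (log_sq_mul_le hK hn hr) (by positivity)).trans
    (schedule_le_pulls K n r)

theorem two_pow_le_pulls (hK : 2 ≤ K) (hn : 1 ≤ n) {r : ℕ} (hr : 1 ≤ r) :
    2 ^ (2 * r + 5) ≤ pulls K n r := by
  have h1 := two_pow_mul_log_le_pulls hK hn hr
  have h2 := log_four_le (four_le_sq_mul hK hn)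
  have : (2 : ℝ) ^ (2 * r + 5) ≤ pulls K n r :=
    le_trans (le_mul_of_one_le_right (by positivity) (by linarith)) h1
  exact_mod_cast this

/-- Each round is at most a constant factor longer than the rounds before it together. -/
theorem pulls_le_twelve_mul (hK : 2 ≤ K) (hn : 1 ≤ n) {r : ℕ} (hr : 2 ≤ r) :
    (pulls K n r : ℝ) ≤ 12 * pullsBefore K n r := by
  obtain ⟨q, rfl⟩ : ∃ q, r = q + 1 := ⟨r - 1, by omega⟩
  have hq : 1 ≤ q := by omega
  have hK' : (2 : ℝ) ≤ K := by exact_mod_cast hK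
  have hn' : (1 : ℝ) ≤ n := by exact_mod_cast hn
  have hq' : (1 : ℝ) ≤ q := by exact_mod_cast hq
  have h1 : (pulls K n q : ℝ) ≤ pullsBefore K n (q + 1) := by
    rw [pullsBefore_succ K n hq]; push_cast; 
    linarith [(Nat.cast_nonneg (pullsBefore K n q) : (0 : ℝ) ≤ _)]
  have h2 : (1 : ℝ) ≤ pulls K n q := by
    have := (Nat.one_le_two_pow).trans (two_pow_le_pulls hK hn hq)
    exact_mod_cast this
  have h3 := pulls_le_schedule_add_one hK hn (show 1 ≤ q + 1 by omega)
  set c := 12 / Real.pi ^ 2 * (K : ℝ) ^ 2 * (q : ℝ) ^ 2 * (n : ℝ) with hc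
  have hc4 : 4 ≤ c := (four_le_sq_mul hK hn).trans (sq_mul_le_logArg hq)
  -- since `q + 1 ≤ 2 q` and `4 ≤ c`, the logarithm at most doubles
  have h4 : Real.log (12 / Real.pi ^ 2 * (K : ℝ) ^ 2 * ((q + 1 : ℕ) : ℝ) ^ 2 * (n : ℝ)) ≤
      2 * Real.log c := by
    have e : 2 * Real.log c = Real.log (c * c) := by
      rw [← sq, Real.log_pow]; norm_num
    rw [e]
    refine Real.log_le_log (by positivity) ?_
    calc 12 / Real.pi ^ 2 * (K : ℝ) ^ 2 * ((q + 1 : ℕ) : ℝ) ^ 2 * (n : ℝ)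
        ≤ 12 / Real.pi ^ 2 * (K : ℝ) ^ 2 * (2 * q : ℝ) ^ 2 * (n : ℝ) := by
          gcongr; push_cast; linarith
      _ = 4 * c := by rw [hc]; ring
      _ ≤ c * c := by gcongr
  have h5 : schedule K n (q + 1) ≤ 8 * schedule K n q := by
    unfold schedule
    calc (2 : ℝ) ^ (2 * (q + 1) + 5) * _ ≤ 2 ^ (2 * (q + 1) + 5) * (2 * Real.log c) := by gcongr
      _ = 8 * (2 ^ (2 * q + 5) * Real.log c) := by ring
  linarith [schedule_le_pulls K n q]

theorem le_of_schedule {m k : ℕ} (h : 2 ^ (2 * k + 3) ≤ m) : k + 1 ≤ m ∧ (k : ℝ) ≤ Real.log m := by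
  constructor
  · exact ((Nat.lt_two_pow_self (n := k)).trans_le
      (Nat.pow_le_pow_right (by norm_num) (by omega))).trans_le h
  · have h' : (2 : ℝ) ^ (2 * k + 3) ≤ m := by exact_mod_cast h
    have := Real.log_le_log (by positivity) h'
    rw [Real.log_pow] at this
    push_cast at this
    nlinarith [Real.log_two_gt_d9, (Nat.cast_nonneg k : (0 : ℝ) ≤ k)]

/-- The number of rounds that are begun within `n` time steps is at most logarithmic in `n`. -/
theorem roundOf_le [NeZero K] (hK : 2 ≤ K) (hn : 1 ≤ n) (y : ℕ → ℝ) :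
    roundOf K n y n ≤ n ∧ (roundOf K n y n : ℝ) ≤ 1 + Real.log n := by
  obtain ⟨g1, g2, -⟩ := roundOf_spec (K := K) hn y hn
  obtain ⟨k, hk⟩ := Nat.exists_eq_add_of_le' g1
  rw [hk] at g2 ⊢
  rcases Nat.eq_zero_or_pos k with rfl | hk0
  · refine ⟨by omega, ?_⟩
    have : 0 ≤ Real.log n := Real.log_natCast_nonneg n
    push_cast; linarith
  · rw [roundState_succ_snd n y hk0] at g2
    have h1 := two_pow_le_pulls hK hn hk0
    have h2 : pulls K n k ≤ (roundState K n y k).1.card * pulls K n k :=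
      Nat.le_mul_of_pos_left _ (roundState_nonempty n y k).card_pos
    have h3 : 2 ^ (2 * k + 3) ≤ 2 ^ (2 * k + 5) := Nat.pow_le_pow_right (by norm_num) (by omega)
    obtain ⟨h4, h5⟩ := le_of_schedule (k := k) (m := n) (by omega)
    exact ⟨h4, by push_cast; linarith⟩

theorem pullsBefore_succ_le (hK : 2 ≤ K) (hn : 1 ≤ n) {v : ℕ} (hv : v ≤ n) :
    (pullsBefore K n (v + 1) : ℝ) ≤ 2 ^ 7 / 3 * (4 ^ v - 1) *
      Real.log (12 / Real.pi ^ 2 * (K : ℝ) ^ 2 * (n : ℝ) ^ 3) + v := by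
  induction v with
  | zero => simp [pullsBefore_one]
  | succ v ih =>
    have ih := ih (by omega)
    have hK' : (2 : ℝ) ≤ K := by exact_mod_cast hK
    have hn' : (1 : ℝ) ≤ n := by exact_mod_cast hn
    have hv' : ((v + 1 : ℕ) : ℝ) ≤ n := by exact_mod_cast hv
    have h3 := pulls_le_schedule_add_one hK hn (show 1 ≤ v + 1 by omega)
    have hlog : Real.log (12 / Real.pi ^ 2 * (K : ℝ) ^ 2 * ((v + 1 : ℕ) : ℝ) ^ 2 * (n : ℝ)) ≤
        Real.log (12 / Real.pi ^ 2 * (K : ℝ) ^ 2 * (n : ℝ) ^ 3) := by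
      refine Real.log_le_log (by positivity) ?_
      calc 12 / Real.pi ^ 2 * (K : ℝ) ^ 2 * ((v + 1 : ℕ) : ℝ) ^ 2 * (n : ℝ)
          ≤ 12 / Real.pi ^ 2 * (K : ℝ) ^ 2 * (n : ℝ) ^ 2 * (n : ℝ) := by gcongr
        _ = _ := by ring
    have h4 : schedule K n (v + 1) ≤ 2 ^ (2 * (v + 1) + 5) *
        Real.log (12 / Real.pi ^ 2 * (K : ℝ) ^ 2 * (n : ℝ) ^ 3) := by
      unfold schedule; gcongr
    rw [pullsBefore_succ K n (by omega)]
    push_cast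
    have e : (2 : ℝ) ^ (2 * (v + 1) + 5) = 2 ^ 7 * 4 ^ v := by
      rw [show (4 : ℝ) = 2 ^ 2 by norm_num, ← pow_mul, ← pow_add]; congr 1; ring
    rw [e] at h4
    have e2 : (4 : ℝ) ^ (v + 1) = 4 * 4 ^ v := pow_succ' _ _
    rw [e2]
    linarith

/-- The total length of the first `v` rounds for one arm. The ceilings in the schedule are paid for
by the term that the geometric series saves, since there are only logarithmically many rounds. -/
theorem pullsBefore_succ_le_of_le (hK : 2 ≤ K) (hn : 1 ≤ n) {v u : ℕ} (hv : v ≤ n) (hvu : v ≤ u)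
    (hlog : (v : ℝ) ≤ 1 + Real.log n) :
    (pullsBefore K n (v + 1) : ℝ) ≤ 4 ^ u / 16 * logFactor K n := by
  have hn' : (1 : ℝ) ≤ n := by exact_mod_cast hn
  have hK' : (2 : ℝ) ≤ K := by exact_mod_cast hK
  have h := pullsBefore_succ_le hK hn hv
  unfold logFactor
  set l := Real.log (12 / Real.pi ^ 2 * (K : ℝ) ^ 2 * (n : ℝ) ^ 3) with hl
  have h1 : 1 + Real.log n ≤ l := by
    have e : l = Real.log (12 / Real.pi ^ 2 * (K : ℝ) ^ 2) + 3 * Real.log n := by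
      rw [hl, Real.log_mul (by positivity) (by positivity), Real.log_pow]; norm_num
    have h2 : 4 ≤ 12 / Real.pi ^ 2 * (K : ℝ) ^ 2 := by
      nlinarith [one_lt_twelve_div_pi_sq]
    linarith [log_four_le h2, Real.log_natCast_nonneg n]
  have h2 : 0 ≤ l := by linarith [Real.log_natCast_nonneg n]
  have h3 : (4 : ℝ) ^ v ≤ 4 ^ u := pow_le_pow_right₀ (by norm_num) hvu
  have h4 := mul_le_mul_of_nonneg_right h3 h2
  linarith

theorem logFactor_nonneg (hK : 1 ≤ K) (hn : 1 ≤ n) : 0 ≤ logFactor K n := by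
  have hK' : (1 : ℝ) ≤ (K : ℝ) ^ 2 := one_le_pow₀ (by exact_mod_cast hK)
  have hn' : (1 : ℝ) ≤ (n : ℝ) ^ 3 := one_le_pow₀ (by exact_mod_cast hn)
  exact mul_nonneg (by norm_num) (Real.log_nonneg
    (one_le_mul_of_one_le_of_one_le
      (one_le_mul_of_one_le_of_one_le one_lt_twelve_div_pi_sq.le hK') hn'))

end

/-! ### Reweightings -/

section

variable {K : ℕ}

/-- The fraction at which `f` is evaluated at the `ℓ`-th pull of arm `i` in round `r`, if round `r`
has active set `S` and begins after `τ` time steps. -/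
def roundFraction (n : ℕ) (T0 : Fin K → ℝ) (r : ℕ) (S : Finset (Fin K)) (τ : ℕ) (i : Fin K)
    (ℓ : ℕ) : ℝ :=
  (T0 i + ∑ r' ∈ Finset.Ico 1 r, (pulls K n r' : ℝ) + ((ℓ : ℝ) - 1)) /
    (totalInit T0 + (τ : ℝ) + (S.card : ℝ) * ((ℓ : ℝ) - 1) + (rankIn S i : ℝ))

theorem avgReweight_eq (n : ℕ) (f : ℝ → ℝ) (T0 : Fin K → ℝ) (r : ℕ) (S : Finset (Fin K)) (τ : ℕ)
    (i : Fin K) : avgReweight n f T0 r S τ i =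
      (∑ ℓ ∈ Finset.Icc 1 (pulls K n r), f (roundFraction n T0 r S τ i ℓ)) / pulls K n r := rfl

theorem le_totalInit {T0 : Fin K → ℝ} (hT0 : ∀ i, 1 ≤ T0 i) (i : Fin K) : T0 i ≤ totalInit T0 :=
  Finset.single_le_sum (f := T0) (fun j _ => zero_le_one.trans (hT0 j)) (Finset.mem_univ i)

theorem card_le_totalInit {T0 : Fin K → ℝ} (hT0 : ∀ i, 1 ≤ T0 i) : (K : ℝ) ≤ totalInit T0 := by
  have := Finset.sum_le_sum fun i (_ : i ∈ Finset.univ) => hT0 i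
  simpa [totalInit] using this

theorem coe_pullsBefore (K n r : ℕ) :
    (pullsBefore K n r : ℝ) = ∑ r' ∈ Finset.Ico 1 r, (pulls K n r' : ℝ) := by
  simp [pullsBefore]

theorem roundFraction_eq (n : ℕ) (T0 : Fin K → ℝ) (r : ℕ) (S : Finset (Fin K)) (τ : ℕ) (i : Fin K)
    (ℓ : ℕ) : roundFraction n T0 r S τ i ℓ = (T0 i + pullsBefore K n r + ((ℓ : ℝ) - 1)) /
      (totalInit T0 + (τ : ℝ) + (S.card : ℝ) * ((ℓ : ℝ) - 1) + (rankIn S i : ℝ)) := by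
  rw [coe_pullsBefore]; rfl

theorem roundFraction_mem {n : ℕ} {T0 : Fin K → ℝ} (hT0 : ∀ i, 1 ≤ T0 i) {r : ℕ}
    {S : Finset (Fin K)} {τ : ℕ} {i : Fin K} {ℓ : ℕ} (hi : i ∈ S) (hℓ : 1 ≤ ℓ)
    (hτ : S.card * pullsBefore K n r ≤ τ) : roundFraction n T0 r S τ i ℓ ∈ Set.Ioc (0 : ℝ) 1 := by
  have hS : (1 : ℝ) ≤ S.card := by exact_mod_cast Finset.card_pos.2 ⟨i, hi⟩
  have hτ' : (S.card : ℝ) * pullsBefore K n r ≤ τ := by exact_mod_cast hτ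
  have hN : (0 : ℝ) ≤ pullsBefore K n r := Nat.cast_nonneg _
  have hl : (0 : ℝ) ≤ (ℓ : ℝ) - 1 := sub_nonneg.2 (by exact_mod_cast hℓ)
  have hb : (0 : ℝ) ≤ rankIn S i := Nat.cast_nonneg _
  have h1 := hT0 i
  have h2 := le_totalInit hT0 i
  have h3 : (pullsBefore K n r : ℝ) ≤ S.card * pullsBefore K n r := le_mul_of_one_le_left hN hS
  have h4 : (ℓ : ℝ) - 1 ≤ S.card * ((ℓ : ℝ) - 1) := le_mul_of_one_le_left hl hS
  rw [roundFraction_eq]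
  have hd : 0 < totalInit T0 + (τ : ℝ) + (S.card : ℝ) * ((ℓ : ℝ) - 1) + (rankIn S i : ℝ) := by
    linarith
  exact ⟨div_pos (by linarith) hd, (div_le_one hd).2 (by linarith)⟩

theorem le_avgReweight {n : ℕ} {f : ℝ → ℝ} {T0 : Fin K → ℝ} {r : ℕ} {S : Finset (Fin K)} {τ : ℕ}
    {i : Fin K} {w : ℝ} (hm : 1 ≤ pulls K n r)
    (h : ∀ ℓ ∈ Finset.Icc 1 (pulls K n r), w ≤ f (roundFraction n T0 r S τ i ℓ)) :
    w ≤ avgReweight n f T0 r S τ i := by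
  have hm' : (0 : ℝ) < pulls K n r := by exact_mod_cast hm
  rw [avgReweight_eq, le_div_iff₀ hm']
  have := Finset.card_nsmul_le_sum _ _ w h
  simpa [mul_comm] using this

theorem avgReweight_le_one {n : ℕ} {f : ℝ → ℝ}
    (hf : ∀ x ∈ Set.Ioc (0 : ℝ) 1, f x ∈ Set.Ioc (0 : ℝ) 1)
    {T0 : Fin K → ℝ} (hT0 : ∀ i, 1 ≤ T0 i) {r : ℕ} {S : Finset (Fin K)} {τ : ℕ}
    {i : Fin K} (hi : i ∈ S) (hτ : S.card * pullsBefore K n r ≤ τ) :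
    avgReweight n f T0 r S τ i ≤ 1 := by
  rw [avgReweight_eq]
  refine div_le_one_of_le₀ ?_ (Nat.cast_nonneg _)
  have := Finset.sum_le_card_nsmul (Finset.Icc 1 (pulls K n r))
    (fun ℓ => f (roundFraction n T0 r S τ i ℓ)) 1
    (fun ℓ hℓ => (hf _ (roundFraction_mem hT0 hi (Finset.mem_Icc.1 hℓ).1 hτ)).2)
  simpa using this

/-- With fewer active arms, now and in the past, the fraction of each active arm is larger. -/
theorem avgReweight_anti {n : ℕ} {f : ℝ → ℝ} (hf_mono : MonotoneOn f (Set.Ioc (0 : ℝ) 1))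
    {T0 : Fin K → ℝ} (hT0 : ∀ i, 1 ≤ T0 i) {r : ℕ} {S U : Finset (Fin K)} {τ τ' : ℕ} {i : Fin K}
    (hi : i ∈ S) (hSU : S ⊆ U) (hττ' : τ ≤ τ') (hτ : S.card * pullsBefore K n r ≤ τ)
    (hτ' : U.card * pullsBefore K n r ≤ τ') :
    avgReweight n f T0 r U τ' i ≤ avgReweight n f T0 r S τ i := by
  rw [avgReweight_eq, avgReweight_eq]
  refine div_le_div_of_nonneg_right (Finset.sum_le_sum fun ℓ hℓ => ?_) (Nat.cast_nonneg _)
  have hl1 := (Finset.mem_Icc.1 hℓ).1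
  refine hf_mono (roundFraction_mem hT0 (hSU hi) hl1 hτ') (roundFraction_mem hT0 hi hl1 hτ) ?_
  have h1 : (S.card : ℝ) ≤ U.card := by exact_mod_cast Finset.card_le_card hSU
  have h2 : (rankIn S i : ℝ) ≤ rankIn U i := by exact_mod_cast rankIn_mono hSU i
  have h3 : (τ : ℝ) ≤ τ' := by exact_mod_cast hττ'
  have hl : (0 : ℝ) ≤ (ℓ : ℝ) - 1 := sub_nonneg.2 (by exact_mod_cast hl1)
  have h4 := (hT0 i)
  have h5 := (le_totalInit hT0 i)
  have hb : (0 : ℝ) ≤ rankIn S i := Nat.cast_nonneg _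
  have hN : (0 : ℝ) ≤ pullsBefore K n r := Nat.cast_nonneg _
  have ht : (0 : ℝ) ≤ τ := Nat.cast_nonneg _
  have hs : 0 ≤ (S.card : ℝ) * ((ℓ : ℝ) - 1) := by positivity
  rw [roundFraction_eq, roundFraction_eq]
  refine div_le_div_of_nonneg_left (by linarith) (by linarith) ?_
  gcongr

variable (n : ℕ) (μ : Fin K → ℝ) (f : ℝ → ℝ) (T0 : Fin K → ℝ)

theorem idealState_succ_snd {r : ℕ} (hr : 1 ≤ r) : (idealState n μ f T0 (r + 1)).2 =
    (idealState n μ f T0 r).2 + (idealState n μ f T0 r).1.card * pulls K n r := by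
  obtain ⟨k, rfl⟩ := Nat.exists_eq_add_of_le' hr
  rfl

theorem mem_idealSet_succ {r : ℕ} (hr : 1 ≤ r) (i : Fin K) : i ∈ idealSet n μ f T0 (r + 1) ↔
    i ∈ idealSet n μ f T0 r ∧ gap μ i * fMin n μ f T0 i r ≤ 2 * (1 / 2 : ℝ) ^ r := by
  obtain ⟨k, rfl⟩ := Nat.exists_eq_add_of_le' hr
  exact Finset.mem_filter

theorem idealSet_antitone {r s : ℕ} (hr : 1 ≤ r) (h : r ≤ s) :
    idealSet n μ f T0 s ⊆ idealSet n μ f T0 r := by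
  induction s, h using Nat.le_induction with
  | base => exact subset_rfl
  | succ s hs ih => exact fun i hi => ih ((mem_idealSet_succ n μ f T0 (hr.trans hs) i).1 hi).1

theorem card_mul_pullsBefore_le_idealState {r : ℕ} (hr : 1 ≤ r) :
    (idealState n μ f T0 r).1.card * pullsBefore K n r ≤ (idealState n μ f T0 r).2 := by
  induction r, hr using Nat.le_induction with
  | base => simp [pullsBefore_one]
  | succ r hr ih =>
    have h := Finset.card_le_card (idealSet_antitone n μ f T0 hr (Nat.le_succ r))
    rw [pullsBefore_succ K n hr, idealState_succ_snd n μ f T0 hr, mul_add]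
    exact add_le_add ((Nat.mul_le_mul_right _ h).trans ih) (Nat.mul_le_mul_right _ h)

theorem idealState_snd_le {r : ℕ} (hr : 1 ≤ r) :
    (idealState n μ f T0 r).2 ≤ K * pullsBefore K n r := by
  induction r, hr using Nat.le_induction with
  | base => simp [pullsBefore_one, idealState]
  | succ r hr ih =>
    have h : (idealState n μ f T0 r).1.card ≤ K := by
      simpa using Finset.card_le_univ (idealState n μ f T0 r).1
    rw [pullsBefore_succ K n hr, idealState_succ_snd n μ f T0 hr, mul_add]
    exact add_le_add ih (Nat.mul_le_mul_right _ h)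

variable {n μ f T0}

/-- Each fraction lies between the initial fraction of the arm, delayed by the arms before it, and
`1 / K`, the limit if all arms were pulled forever. -/
theorem min_le_roundFraction [NeZero K] (hT0 : ∀ i, 1 ≤ T0 i) {r : ℕ} {S : Finset (Fin K)} {τ : ℕ}
    {i : Fin K} {ℓ : ℕ} (hℓ : 1 ≤ ℓ) (hτ : τ ≤ K * pullsBefore K n r) :
    min (T0 i / (totalInit T0 + ((i : ℕ) : ℝ))) (1 / (K : ℝ)) ≤ roundFraction n T0 r S τ i ℓ := by
  have hK : (0 : ℝ) < K := by exact_mod_cast Nat.pos_of_ne_zero (NeZero.ne K)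
  have hS : (S.card : ℝ) ≤ K := by exact_mod_cast (by simpa using Finset.card_le_univ S)
  have hτ' : (τ : ℝ) ≤ K * pullsBefore K n r := by exact_mod_cast hτ
  have hN : (0 : ℝ) ≤ pullsBefore K n r := Nat.cast_nonneg _
  have hl : (0 : ℝ) ≤ (ℓ : ℝ) - 1 := sub_nonneg.2 (by exact_mod_cast hℓ)
  have hb : (rankIn S i : ℝ) ≤ (i : ℕ) := by exact_mod_cast rankIn_le_val S i
  have hb0 : (0 : ℝ) ≤ rankIn S i := Nat.cast_nonneg _
  have ht : (0 : ℝ) ≤ τ := Nat.cast_nonneg _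
  have h1 := hT0 i
  have h2 := le_totalInit hT0 i
  have h3 : (S.card : ℝ) * ((ℓ : ℝ) - 1) ≤ K * ((ℓ : ℝ) - 1) := by gcongr
  have h4 : 0 ≤ (S.card : ℝ) * ((ℓ : ℝ) - 1) := by positivity
  set q := min (T0 i / (totalInit T0 + ((i : ℕ) : ℝ))) (1 / (K : ℝ)) with hq
  have hi0 : (0 : ℝ) ≤ (i : ℕ) := Nat.cast_nonneg _
  have hq1 : q * (totalInit T0 + ((i : ℕ) : ℝ)) ≤ T0 i :=
    (le_div_iff₀ (by linarith)).1 (min_le_left _ _)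
  have hq2 : q * K ≤ 1 := (le_div_iff₀ hK).1 (min_le_right _ _)
  have hq0 : 0 ≤ q := le_min (div_nonneg (by linarith) (by linarith)) (by positivity)
  rw [roundFraction_eq, le_div_iff₀ (by linarith)]
  calc q * (totalInit T0 + τ + S.card * ((ℓ : ℝ) - 1) + rankIn S i)
      ≤ q * (totalInit T0 + K * pullsBefore K n r + K * ((ℓ : ℝ) - 1) + (i : ℕ)) := by gcongr
    _ = q * (totalInit T0 + (i : ℕ)) + q * K * (pullsBefore K n r + ((ℓ : ℝ) - 1)) := by ring
    _ ≤ T0 i + 1 * (pullsBefore K n r + ((ℓ : ℝ) - 1)) := by gcongr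
    _ = _ := by ring

theorem min_mem_Ioc [NeZero K] (hT0 : ∀ i, 1 ≤ T0 i) (i : Fin K) :
    min (T0 i / (totalInit T0 + ((i : ℕ) : ℝ))) (1 / (K : ℝ)) ∈ Set.Ioc (0 : ℝ) 1 := by
  have hK : (1 : ℝ) ≤ K := by exact_mod_cast Nat.pos_of_ne_zero (NeZero.ne K)
  have h1 := hT0 i
  have h2 := le_totalInit hT0 i
  have hi0 : (0 : ℝ) ≤ (i : ℕ) := Nat.cast_nonneg _
  exact ⟨lt_min (div_pos (by linarith) (by linarith)) (by positivity),
    (min_le_right _ _).trans (by rw [div_le_one (by linarith)]; exact hK)⟩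

theorem le_fMin [NeZero K] (hn : 1 ≤ n) (hf_mono : MonotoneOn f (Set.Ioc (0 : ℝ) 1))
    (hT0 : ∀ i, 1 ≤ T0 i) {r : ℕ} (hr : 1 ≤ r) {i : Fin K} (hi : i ∈ idealSet n μ f T0 r) :
    f (min (T0 i / (totalInit T0 + ((i : ℕ) : ℝ))) (1 / (K : ℝ))) ≤ fMin n μ f T0 i r := by
  refine le_avgReweight (pulls_pos hn hr) fun ℓ hℓ => ?_
  have hl := (Finset.mem_Icc.1 hℓ).1
  exact hf_mono (min_mem_Ioc hT0 i)
    (roundFraction_mem hT0 hi hl (card_mul_pullsBefore_le_idealState n μ f T0 hr))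
    (min_le_roundFraction hT0 hl (idealState_snd_le n μ f T0 hr))

theorem fMin_le_one (hf : ∀ x ∈ Set.Ioc (0 : ℝ) 1, f x ∈ Set.Ioc (0 : ℝ) 1)
    (hT0 : ∀ i, 1 ≤ T0 i) {r : ℕ} (hr : 1 ≤ r) {i : Fin K} (hi : i ∈ idealSet n μ f T0 r) :
    fMin n μ f T0 i r ≤ 1 :=
  avgReweight_le_one hf hT0 hi (card_mul_pullsBefore_le_idealState n μ f T0 hr)

/-- When the initial biases do not exceed the length of the first round, the fractions are of order
`1 / K` from the second round on. -/
theorem le_fMin_of_two_le [NeZero K] (hn : 1 ≤ n) (hf_mono : MonotoneOn f (Set.Ioc (0 : ℝ) 1))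
    (hT0 : ∀ i, 1 ≤ T0 i) (hm : ∀ i, T0 i ≤ pulls K n 1) {r : ℕ} (hr : 2 ≤ r) {i : Fin K}
    (hi : i ∈ idealSet n μ f T0 r) : f (1 / (15 * (K : ℝ))) ≤ fMin n μ f T0 i r := by
  have hK : (1 : ℝ) ≤ K := by exact_mod_cast Nat.pos_of_ne_zero (NeZero.ne K)
  refine le_avgReweight (pulls_pos hn (by omega)) fun ℓ hℓ => ?_
  have hl1 := (Finset.mem_Icc.1 hℓ).1
  refine hf_mono ⟨by positivity, (div_le_one (by positivity)).2 (by linarith)⟩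
    (roundFraction_mem hT0 hi hl1 (card_mul_pullsBefore_le_idealState n μ f T0 (by omega))) ?_
  set S := (idealState n μ f T0 r).1 with hSd
  have hS : (S.card : ℝ) ≤ K := by exact_mod_cast (by simpa using Finset.card_le_univ S)
  have hτ' : ((idealState n μ f T0 r).2 : ℝ) ≤ K * pullsBefore K n r := by
    exact_mod_cast idealState_snd_le n μ f T0 (by omega)
  have hmN : (pulls K n 1 : ℝ) ≤ pullsBefore K n r := by
    exact_mod_cast pulls_one_le_pullsBefore K n hr
  have hN : (0 : ℝ) ≤ pullsBefore K n r := Nat.cast_nonneg _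
  have hl : (0 : ℝ) ≤ (ℓ : ℝ) - 1 := sub_nonneg.2 (by exact_mod_cast hl1)
  have hb : (rankIn S i : ℝ) ≤ K := by
    exact_mod_cast (rankIn_le_val S i).trans i.2.le
  have ht0 : totalInit T0 ≤ K * pullsBefore K n r := by
    have := Finset.sum_le_sum fun j (_ : j ∈ Finset.univ) => (hm j).trans hmN
    simpa [totalInit] using this
  have hb0 : (0 : ℝ) ≤ rankIn S i := Nat.cast_nonneg _
  have ht : (0 : ℝ) ≤ (idealState n μ f T0 r).2 := Nat.cast_nonneg _
  have h1 := hT0 i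
  have h2 := le_totalInit hT0 i
  have h3 : (S.card : ℝ) * ((ℓ : ℝ) - 1) ≤ K * ((ℓ : ℝ) - 1) := by gcongr
  have h4 : 0 ≤ (S.card : ℝ) * ((ℓ : ℝ) - 1) := by positivity
  rw [roundFraction_eq, div_le_div_iff₀ (by positivity) (by linarith), one_mul]
  calc totalInit T0 + (idealState n μ f T0 r).2 + S.card * ((ℓ : ℝ) - 1) + rankIn S i
      ≤ K * pullsBefore K n r + K * pullsBefore K n r + K * ((ℓ : ℝ) - 1) + K := by
        gcongr
    _ = (2 * pullsBefore K n r + ((ℓ : ℝ) - 1) + 1) * K := by ring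
    _ ≤ (15 * (T0 i + pullsBefore K n r + ((ℓ : ℝ) - 1))) * K := by
        gcongr; linarith
    _ = _ := by ring

theorem lastRound_spec [NeZero K] (hn : 1 ≤ n)
    (hf : ∀ x ∈ Set.Ioc (0 : ℝ) 1, f x ∈ Set.Ioc (0 : ℝ) 1)
    (hf_mono : MonotoneOn f (Set.Ioc (0 : ℝ) 1)) (hT0 : ∀ i, 1 ≤ T0 i) {i : Fin K}
    (hi : 0 < gap μ i) (hi1 : gap μ i ≤ 1) :
    2 ≤ lastRound n μ f T0 i ∧ i ∉ idealSet n μ f T0 (lastRound n μ f T0 i + 1) ∧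
      ∀ r, 1 ≤ r → r ≤ lastRound n μ f T0 i → i ∈ idealSet n μ f T0 r := by
  have hne : {r : ℕ | 1 ≤ r ∧ i ∉ idealSet n μ f T0 (r + 1)}.Nonempty := by
    by_contra hcon
    rw [Set.not_nonempty_iff_eq_empty, Set.eq_empty_iff_forall_notMem] at hcon
    have hall : ∀ r, 1 ≤ r → i ∈ idealSet n μ f T0 (r + 1) := by
      intro r hr
      by_contra h
      exact hcon r ⟨hr, h⟩
    have hw := (hf _ (min_mem_Ioc hT0 i)).1
    obtain ⟨k, hk⟩ := exists_pow_lt_of_lt_one (mul_pos hi hw) (show (1 / 2 : ℝ) < 1 by norm_num)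
    obtain ⟨h1, h2⟩ := (mem_idealSet_succ n μ f T0 (Nat.le_add_left 1 k) i).1
      (hall (k + 1) (Nat.le_add_left 1 k))
    have h3 := mul_le_mul_of_nonneg_left (le_fMin hn hf_mono hT0 (Nat.le_add_left 1 k) h1) hi.le
    rw [pow_succ] at h2
    linarith
  have hspec := Nat.sInf_mem hne
  have hmem : ∀ r, 1 ≤ r → r ≤ lastRound n μ f T0 i → i ∈ idealSet n μ f T0 r := by
    intro r hr hru
    rcases eq_or_lt_of_le hr with rfl | hr2
    · exact Finset.mem_univ i
    · obtain ⟨q, rfl⟩ : ∃ q, r = q + 1 := ⟨r - 1, by omega⟩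
      by_contra hcon
      have : lastRound n μ f T0 i ≤ q := Nat.sInf_le ⟨by omega, hcon⟩
      omega
  refine ⟨?_, hspec.2, hmem⟩
  by_contra! hlt
  have h1 : lastRound n μ f T0 i = 1 := le_antisymm (by omega) hspec.1
  have hU1 : i ∈ idealSet n μ f T0 1 := Finset.mem_univ i
  have h2 : i ∉ idealSet n μ f T0 (1 + 1) := by
    have h : i ∉ idealSet n μ f T0 (lastRound n μ f T0 i + 1) := hspec.2
    rwa [h1] at h
  refine h2 ((mem_idealSet_succ n μ f T0 le_rfl i).2 ⟨hU1, ?_⟩)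
  have h3 := mul_le_mul hi1 (fMin_le_one hf hT0 le_rfl hU1)
    ((hf _ (min_mem_Ioc hT0 i)).1.le.trans (le_fMin hn hf_mono hT0 le_rfl hU1)) zero_le_one
  norm_num at h3 ⊢
  exact h3

end

/-! ### Arms of the same round have similar reweightings -/

section

variable {K n : ℕ}

theorem inv_le_log_sub_log {x : ℝ} (hx : 0 < x) :
    1 / (x + 1) ≤ Real.log (x + 1) - Real.log x := by
  rw [← Real.log_div (by linarith) hx.ne']
  have := Real.one_sub_inv_le_log_of_pos (show 0 < (x + 1) / x by positivity)
  refine le_trans (le_of_eq ?_) this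
  field_simp
  ring

theorem sum_inv_le_log {N : ℝ} (hN : 0 < N) (m : ℕ) :
    ∑ ℓ ∈ Finset.Icc 1 m, 1 / (N + (ℓ : ℝ)) ≤ Real.log (1 + m / N) := by
  have h : ∑ ℓ ∈ Finset.Icc 1 m, 1 / (N + (ℓ : ℝ)) ≤ Real.log (N + m) - Real.log N := by
    induction m with
    | zero => simp
    | succ m ih =>
      rw [Finset.sum_Icc_succ_top (by omega)]
      have := inv_le_log_sub_log (show 0 < N + (m : ℝ) by positivity)
      push_cast
      rw [← add_assoc]
      linarith
  refine h.trans (le_of_eq ?_)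
  rw [← Real.log_div (by positivity) hN.ne']
  congr 1
  field_simp

theorem roundFraction_sub_le {T0 : Fin K → ℝ} (hT0 : ∀ i, 1 ≤ T0 i) {D : ℝ}
    (hD : ∀ i j, T0 j - T0 i ≤ D) (hD0 : 0 ≤ D) {r : ℕ} {S : Finset (Fin K)} {τ : ℕ} {i j : Fin K}
    {ℓ : ℕ} (hi : i ∈ S) (hℓ : 1 ≤ ℓ) (hτ : S.card * pullsBefore K n r ≤ τ) {κ : ℝ}
    (hκ : 0 < κ) (hκS : κ ≤ S.card) :
    roundFraction n T0 r S τ j ℓ - roundFraction n T0 r S τ i ℓ ≤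
      (1 + D / κ) * (1 / (pullsBefore K n r + (ℓ : ℝ))) := by
  have hx := (roundFraction_mem hT0 hi hℓ hτ).2
  have hx0 := (roundFraction_mem hT0 hi hℓ hτ).1
  have hτ' : (S.card : ℝ) * pullsBefore K n r ≤ τ := by exact_mod_cast hτ
  have hN : (0 : ℝ) ≤ pullsBefore K n r := Nat.cast_nonneg _
  have hl : (1 : ℝ) ≤ (ℓ : ℝ) := by exact_mod_cast hℓ
  have hS1 : (0 : ℝ) < S.card := hκ.trans_le hκS
  have hSK : (S.card : ℝ) ≤ totalInit T0 :=
    le_trans (by exact_mod_cast (by simpa using Finset.card_le_univ S)) (card_le_totalInit hT0)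
  have hbi : (rankIn S i : ℝ) ≤ S.card := by exact_mod_cast (rankIn_lt hi).le
  have hbi0 : (0 : ℝ) ≤ rankIn S i := Nat.cast_nonneg _
  have hbj0 : (0 : ℝ) ≤ rankIn S j := Nat.cast_nonneg _
  rw [roundFraction_eq] at hx hx0 ⊢
  rw [roundFraction_eq]
  set N := (pullsBefore K n r : ℝ)
  set E := totalInit T0 + (τ : ℝ) + (S.card : ℝ) * ((ℓ : ℝ) - 1) with hE
  have hES : (S.card : ℝ) * (N + ℓ) ≤ E := by rw [hE]; linarith
  have hNl : 0 < N + ℓ := by linarith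
  have hEκ : κ * (N + ℓ) ≤ E := (mul_le_mul_of_nonneg_right hκS hNl.le).trans hES
  have hE0 : 0 < E := (mul_pos hκ hNl).trans_le hEκ
  set x := (T0 i + N + ((ℓ : ℝ) - 1)) / (E + rankIn S i) with hxd
  -- `x_j - x_i = (T⁰_j - T⁰_i) / (E + b_j) + x_i (b_i - b_j) / (E + b_j)`
  have hx1 : T0 i + N + ((ℓ : ℝ) - 1) = x * (E + rankIn S i) :=
    (div_mul_cancel₀ _ (by positivity)).symm
  have e : (T0 j + N + ((ℓ : ℝ) - 1)) / (E + rankIn S j) - x =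
      (T0 j - T0 i + x * ((rankIn S i : ℝ) - rankIn S j)) / (E + rankIn S j) := by
    rw [div_sub' (by linarith)]
    congr 1
    linear_combination hx1
  have hEj : 0 < E + (rankIn S j : ℝ) := by linarith
  rw [e, div_le_iff₀ hEj]
  have h1 : x * ((rankIn S i : ℝ) - rankIn S j) ≤ S.card := by
    calc x * ((rankIn S i : ℝ) - rankIn S j) ≤ x * S.card :=
          mul_le_mul_of_nonneg_left (by linarith) hx0.le
      _ ≤ 1 * S.card := mul_le_mul_of_nonneg_right hx hS1.le
      _ = _ := one_mul _
  have h2 : (S.card : ℝ) ≤ 1 / (N + ℓ) * (E + rankIn S j) := by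
    rw [one_div, ← div_eq_inv_mul, le_div_iff₀ hNl]; linarith
  have h3 : D ≤ D / κ * (1 / (N + ℓ) * (E + rankIn S j)) := by
    rw [show D / κ * (1 / (N + ℓ) * (E + rankIn S j)) = D * ((E + rankIn S j) / (κ * (N + ℓ))) by
      field_simp]
    refine le_mul_of_one_le_right hD0 ?_
    rw [one_le_div (mul_pos hκ hNl)]
    linarith
  have := hD i j
  linarith

theorem abs_roundFraction_sub_le {T0 : Fin K → ℝ} (hT0 : ∀ i, 1 ≤ T0 i) {D : ℝ}
    (hD : ∀ i j, T0 j - T0 i ≤ D) (hD0 : 0 ≤ D) {r : ℕ} {S : Finset (Fin K)} {τ : ℕ} {i j : Fin K}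
    {ℓ : ℕ} (hi : i ∈ S) (hj : j ∈ S) (hℓ : 1 ≤ ℓ) (hτ : S.card * pullsBefore K n r ≤ τ) {κ : ℝ}
    (hκ : 0 < κ) (hκS : κ ≤ S.card) :
    |roundFraction n T0 r S τ j ℓ - roundFraction n T0 r S τ i ℓ| ≤
      (1 + D / κ) * (1 / (pullsBefore K n r + (ℓ : ℝ))) :=
  abs_sub_le_iff.2 ⟨roundFraction_sub_le hT0 hD hD0 hi hℓ hτ hκ hκS,
    roundFraction_sub_le hT0 hD hD0 hj hℓ hτ hκ hκS⟩

/-- The fractions of two arms that are active in the same round have a bounded total difference over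
this round: the harmonic sum that bounds it is logarithmic in the first round, and bounded in all
later rounds, since these are only a constant factor longer than all that precedes them. -/
theorem sum_abs_roundFraction_sub_le (hK : 2 ≤ K) (hn : 1 ≤ n) {T0 : Fin K → ℝ}
    (hT0 : ∀ i, 1 ≤ T0 i) {D : ℝ} (hD : ∀ i j, T0 j - T0 i ≤ D) (hD0 : 0 ≤ D) {r : ℕ} (hr : 1 ≤ r)
    {S : Finset (Fin K)} {τ : ℕ} {i j : Fin K} (hi : i ∈ S) (hj : j ∈ S)
    (hτ : S.card * pullsBefore K n r ≤ τ) (h1S : r = 1 → S = Finset.univ) :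
    ∑ ℓ ∈ Finset.Icc 1 (pulls K n r),
      |roundFraction n T0 r S τ j ℓ - roundFraction n T0 r S τ i ℓ| ≤
      1 + max ((1 + D / (K : ℝ)) *
          Real.log (1 + 2 ^ 8 * Real.log (12 / Real.pi ^ 2 * (K : ℝ) ^ 2 * (n : ℝ))))
        ((1 + D) * Real.log 13) := by
  have hK0 : (0 : ℝ) < K := by exact_mod_cast (by omega : 0 < K)
  rcases eq_or_lt_of_le hr with rfl | hr2
  · obtain rfl := h1S rfl
    obtain ⟨m, hm⟩ : ∃ m, pulls K n 1 = m + 1 :=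
      Nat.exists_eq_add_of_le' (Nat.one_le_two_pow.trans (two_pow_le_pulls hK hn le_rfl))
    have hsplit : ∀ g : ℕ → ℝ, ∑ ℓ ∈ Finset.Icc 1 (m + 1), g ℓ =
        g 1 + ∑ ℓ ∈ Finset.Icc 1 m, g (ℓ + 1) := by
      intro g
      clear hm
      induction m with
      | zero => simp
      | succ m ih =>
        rw [Finset.sum_Icc_succ_top (by omega), ih, Finset.sum_Icc_succ_top (by omega), add_assoc]
    rw [hm, hsplit]
    have hms : (m : ℝ) ≤ schedule K n 1 := by
      have := pulls_le_schedule_add_one hK hn (le_refl 1)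
      rw [hm] at this; push_cast at this; linarith
    -- for the first pull the trivial bound keeps the constant `1` free of the factor `1 + D / K`
    have h1 : |roundFraction n T0 1 Finset.univ τ j 1 -
        roundFraction n T0 1 Finset.univ τ i 1| ≤ 1 := by
      have hx := roundFraction_mem hT0 hi (le_refl 1) hτ
      have hy := roundFraction_mem hT0 hj (le_refl 1) hτ
      exact abs_sub_le_iff.2 ⟨by linarith [hx.1, hy.2], by linarith [hy.1, hx.2]⟩
    refine add_le_add h1 (le_trans ?_ (le_max_left _ _))
    calc ∑ ℓ ∈ Finset.Icc 1 m, |roundFraction n T0 1 Finset.univ τ j (ℓ + 1) -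
            roundFraction n T0 1 Finset.univ τ i (ℓ + 1)|
        ≤ ∑ ℓ ∈ Finset.Icc 1 m, (1 + D / (K : ℝ)) * (1 / (1 + (ℓ : ℝ))) := by
          refine Finset.sum_le_sum fun ℓ _ => ?_
          have := abs_roundFraction_sub_le hT0 hD hD0 hi hj (Nat.le_add_left 1 ℓ) hτ hK0 (by simp)
          rw [pullsBefore_one] at this
          push_cast at this
          rwa [zero_add, add_comm (ℓ : ℝ) 1] at this
      _ = (1 + D / (K : ℝ)) * ∑ ℓ ∈ Finset.Icc 1 m, 1 / (1 + (ℓ : ℝ)) := (Finset.mul_sum _ _ _).symm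
      _ ≤ (1 + D / (K : ℝ)) * Real.log (1 + m / 1) := by
          gcongr
          exact sum_inv_le_log one_pos m
      _ ≤ _ := by
          gcongr
          have hl := log_four_le ((four_le_sq_mul hK hn).trans (sq_mul_le_logArg (le_refl 1)))
          simp only [Nat.cast_one, one_pow, mul_one] at hl
          unfold schedule at hms
          simp only [Nat.cast_one, one_pow, mul_one] at hms
          norm_num at hms hl ⊢
          linarith
  · have hN1 : (1 : ℝ) ≤ pullsBefore K n r := by
      exact_mod_cast (Nat.one_le_two_pow.trans (two_pow_le_pulls hK hn le_rfl)).trans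
        (pulls_one_le_pullsBefore K n hr2)
    have hS1 : (1 : ℝ) ≤ S.card := by exact_mod_cast Finset.card_pos.2 ⟨i, hi⟩
    calc ∑ ℓ ∈ Finset.Icc 1 (pulls K n r),
          |roundFraction n T0 r S τ j ℓ - roundFraction n T0 r S τ i ℓ|
        ≤ ∑ ℓ ∈ Finset.Icc 1 (pulls K n r), (1 + D / 1) * (1 / (pullsBefore K n r + (ℓ : ℝ))) :=
          Finset.sum_le_sum fun ℓ hℓ => abs_roundFraction_sub_le hT0 hD hD0 hi hj
            (Finset.mem_Icc.1 hℓ).1 hτ one_pos hS1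
      _ = (1 + D) * ∑ ℓ ∈ Finset.Icc 1 (pulls K n r), 1 / (pullsBefore K n r + (ℓ : ℝ)) := by
          rw [div_one, Finset.mul_sum]
      _ ≤ (1 + D) * Real.log (1 + pulls K n r / pullsBefore K n r) := by
          gcongr
          exact sum_inv_le_log (by linarith) _
      _ ≤ (1 + D) * Real.log 13 := by
          gcongr
          have := (div_le_iff₀ (by linarith)).2 (pulls_le_twelve_mul hK hn hr2)
          linarith
      _ ≤ _ := by
          linarith [le_max_right ((1 + D / (K : ℝ)) *
            Real.log (1 + 2 ^ 8 * Real.log (12 / Real.pi ^ 2 * (K : ℝ) ^ 2 * (n : ℝ))))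
            ((1 + D) * Real.log 13)]

theorem mul_avgReweight_sub_le (hK : 2 ≤ K) (hn : 1 ≤ n) {f : ℝ → ℝ} {L : ℝ≥0}
    (hf_lip : LipschitzOnWith L f (Set.Ioc (0 : ℝ) 1)) {T0 : Fin K → ℝ}
    (hT0 : ∀ i, 1 ≤ T0 i) {D : ℝ} (hD : ∀ i j, T0 j - T0 i ≤ D) (hD0 : 0 ≤ D) {M : ℝ} (hM : 0 ≤ M)
    (hlarge : M * (L : ℝ) / 2 ^ 5 * (1 + max ((1 + D / (K : ℝ)) *
          Real.log (1 + 2 ^ 8 * Real.log (12 / Real.pi ^ 2 * (K : ℝ) ^ 2 * (n : ℝ))))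
        ((1 + D) * Real.log 13)) ≤ Real.log ((n : ℝ) * (K : ℝ)))
    {r : ℕ} (hr : 1 ≤ r)
    {S : Finset (Fin K)} {τ : ℕ} {i j : Fin K} (hi : i ∈ S) (hj : j ∈ S)
    (hτ : S.card * pullsBefore K n r ≤ τ) (h1S : r = 1 → S = Finset.univ) :
    M * (avgReweight n f T0 r S τ j - avgReweight n f T0 r S τ i) ≤ (1 / 2 : ℝ) ^ (r + 1) := by
  have hm : (0 : ℝ) < pulls K n r := by
    exact_mod_cast (two_pow_le_pulls hK hn hr).trans_lt' (by positivity)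
  have hsum := sum_abs_roundFraction_sub_le hK hn hT0 hD hD0 hr hi hj hτ h1S
  set W := 1 + max ((1 + D / (K : ℝ)) *
          Real.log (1 + 2 ^ 8 * Real.log (12 / Real.pi ^ 2 * (K : ℝ) ^ 2 * (n : ℝ))))
        ((1 + D) * Real.log 13)
  rw [avgReweight_eq, avgReweight_eq, ← sub_div, ← Finset.sum_sub_distrib, ← mul_div_assoc,
    div_le_iff₀ hm]
  have h1 : ∑ ℓ ∈ Finset.Icc 1 (pulls K n r),
      (f (roundFraction n T0 r S τ j ℓ) - f (roundFraction n T0 r S τ i ℓ)) ≤ L * W := by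
    refine le_trans (Finset.sum_le_sum fun ℓ hℓ => ?_)
      ((Finset.mul_sum _ _ _).symm.le.trans (mul_le_mul_of_nonneg_left hsum L.2))
    have hl := (Finset.mem_Icc.1 hℓ).1
    have := hf_lip.dist_le_mul _ (roundFraction_mem hT0 hj hl hτ) _
      (roundFraction_mem hT0 hi hl hτ)
    rw [Real.dist_eq, Real.dist_eq] at this
    exact (le_abs_self _).trans this
  have hnK : Real.log ((n : ℝ) * K) ≤ Real.log ((K : ℝ) ^ 2 * n) := by
    have hK' : (2 : ℝ) ≤ K := by exact_mod_cast hK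
    have hn' : (1 : ℝ) ≤ n := by exact_mod_cast hn
    refine Real.log_le_log (by positivity) ?_
    rw [mul_comm, sq]
    gcongr
    nlinarith
  have hp := two_pow_mul_log_le_pulls hK hn hr
  have h2 : (1 / 2 : ℝ) ^ (r + 1) * 2 ^ (2 * r + 5) = 2 ^ (r + 4) := by
    rw [show 2 * r + 5 = (r + 1) + (r + 4) by ring, pow_add 2,
      ← mul_assoc, ← mul_pow]; norm_num
  have h3 : (2 : ℝ) ^ 5 ≤ 2 ^ (r + 4) := pow_le_pow_right₀ (by norm_num) (by omega)
  have hl0 : 0 ≤ Real.log ((K : ℝ) ^ 2 * n) :=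
    le_trans (by norm_num) (log_four_le (four_le_sq_mul hK hn))
  calc M * _ ≤ M * (L * W) := by gcongr
    _ = 2 ^ 5 * (M * L / 2 ^ 5 * W) := by ring
    _ ≤ 2 ^ 5 * Real.log ((K : ℝ) ^ 2 * n) := by gcongr; exact hlarge.trans hnK
    _ ≤ 2 ^ (r + 4) * Real.log ((K : ℝ) ^ 2 * n) := by gcongr
    _ = (1 / 2 : ℝ) ^ (r + 1) * (2 ^ (2 * r + 5) * Real.log ((K : ℝ) ^ 2 * n)) := by
        rw [← h2]; ring
    _ ≤ _ := by gcongr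

end

/-! ### Runs of the algorithm with small noise -/

section

variable {K n : ℕ}

/-- Along the feedback sequence `y`, in every round `r` that is completed within `n` time steps
the deviations of the empirical means of arm `a` and of each other active arm from their conditional
means differ by at most `2^(-r-1)`. -/
def NoiseSmall (n : ℕ) (μ : Fin K → ℝ) (f : ℝ → ℝ) (T0 : Fin K → ℝ) (a : Fin K) (y : ℕ → ℝ) :
    Prop :=
  ∀ r, 1 ≤ r → (roundState K n y (r + 1)).2 ≤ n → a ∈ (roundState K n y r).1 →
    ∀ j ∈ (roundState K n y r).1,
      |(empMean n y r (roundState K n y r).1 (roundState K n y r).2 j -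
          μ j * avgReweight n f T0 r (roundState K n y r).1 (roundState K n y r).2 j) -
        (empMean n y r (roundState K n y r).1 (roundState K n y r).2 a -
          μ a * avgReweight n f T0 r (roundState K n y r).1 (roundState K n y r).2 a)| ≤
        (1 / 2 : ℝ) ^ (r + 1)

/-- If the noise is small and the reweightings of arms of the same round are similar, then the best
arm survives, and every other arm is eliminated at least as early as from the sets `U_r`. -/
theorem best_mem_and_subset_idealSet [NeZero K] (hn : 1 ≤ n) {μ : Fin K → ℝ} {f : ℝ → ℝ}
    {T0 : Fin K → ℝ} (hT0 : ∀ i, 1 ≤ T0 i)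
    (hf : ∀ x ∈ Set.Ioc (0 : ℝ) 1, f x ∈ Set.Ioc (0 : ℝ) 1)
    (hf_mono : MonotoneOn f (Set.Ioc (0 : ℝ) 1)) {a : Fin K} (ha : ∀ j, μ j ≤ μ a)
    (hgap : ∀ j, gap μ j = μ a - μ j) {y : ℕ → ℝ} (hy : NoiseSmall n μ f T0 a y)
    (hdrift : ∀ r, 1 ≤ r → ∀ i ∈ (roundState K n y r).1, ∀ j ∈ (roundState K n y r).1,
      μ a * (avgReweight n f T0 r (roundState K n y r).1 (roundState K n y r).2 j -
        avgReweight n f T0 r (roundState K n y r).1 (roundState K n y r).2 i) ≤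
          (1 / 2 : ℝ) ^ (r + 1))
    {r : ℕ} (hr : 1 ≤ r) (hrn : (roundState K n y r).2 ≤ n) :
    a ∈ (roundState K n y r).1 ∧ (roundState K n y r).1 ⊆ idealSet n μ f T0 r ∧
      (roundState K n y r).2 ≤ (idealState n μ f T0 r).2 := by
  induction r, hr using Nat.le_induction with
  | base => exact ⟨Finset.mem_univ a, subset_rfl, le_rfl⟩
  | succ r hr ih =>
    obtain ⟨h1, h2, h3⟩ := ih ((roundState_snd_mono (K := K) n y (Nat.le_succ r)).trans hrn)
    have hnoise := hy r hr hrn h1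
    have hdr := hdrift r hr
    have hτ := card_mul_pullsBefore_le (K := K) n y hr
    have hpow : (1 / 2 : ℝ) ^ (r + 1) = (1 / 2 : ℝ) ^ r / 2 := by rw [pow_succ]; ring
    rw [roundState_succ_fst n y hr]
    have hF0 : ∀ j ∈ (roundState K n y r).1,
        0 ≤ avgReweight n f T0 r (roundState K n y r).1 (roundState K n y r).2 j := fun j hj =>
      le_avgReweight (pulls_pos hn hr) fun ℓ hℓ =>
        (hf _ (roundFraction_mem hT0 hj (Finset.mem_Icc.1 hℓ).1 hτ)).1.le
    refine ⟨Finset.mem_filter.2 ⟨h1, fun j hj => ?_⟩, fun i hi => ?_, ?_⟩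
    · have e1 := (abs_le.1 (hnoise j hj)).2
      have e2 := hdr a h1 j hj
      have e3 := mul_le_mul_of_nonneg_right (ha j) (hF0 j hj)
      rw [hpow] at e1 e2
      linarith
    · obtain ⟨hi, hkeep⟩ := Finset.mem_filter.1 hi
      refine (mem_idealSet_succ n μ f T0 hr i).2 ⟨h2 hi, ?_⟩
      have e1 := (abs_le.1 (hnoise i hi)).2
      have e2 := hdr a h1 i hi
      have e3 := hkeep a h1
      have e4 := avgReweight_anti hf_mono hT0 hi h2 h3 hτ
        (card_mul_pullsBefore_le_idealState n μ f T0 hr)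
      have e5 := mul_le_mul_of_nonneg_left e4 (show 0 ≤ gap μ i by rw [hgap]; linarith [ha i])
      have e6 := (abs_le.1 (hnoise i hi)).1
      have e7 := hdr i hi a h1
      rw [hgap] at e5 ⊢
      rw [hpow] at e1 e2 e6 e7
      refine e5.trans ?_
      linarith
    · rw [roundState_succ_snd n y hr, idealState_succ_snd n μ f T0 hr]
      exact add_le_add h3 (Nat.mul_le_mul_right _ (Finset.card_le_card h2))

theorem playCount_le_of_subset_idealSet [NeZero K] (hn : 1 ≤ n) {μ : Fin K → ℝ} {f : ℝ → ℝ}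
    {T0 : Fin K → ℝ} {y : ℕ → ℝ}
    (hsub : ∀ r, 1 ≤ r → (roundState K n y r).2 ≤ n →
      (roundState K n y r).1 ⊆ idealSet n μ f T0 r)
    {i : Fin K} {u : ℕ} (hu : i ∉ idealSet n μ f T0 (u + 1)) :
    playCount (fun t => elimArm n y t) i n ≤
      pullsBefore K n (min u (roundOf K n y n) + 1) := by
  obtain ⟨g1, g2, g3⟩ := roundOf_spec (K := K) hn y hn
  refine (playCount_mono _ i g3).trans ?_
  rw [playCount_roundState hn y (by omega), ← Finset.sum_filter]
  refine Finset.sum_le_sum_of_subset fun r hr => ?_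
  obtain ⟨hr, hir⟩ := Finset.mem_filter.1 hr
  obtain ⟨h1, h2⟩ := Finset.mem_Ico.1 hr
  have h3 := hsub r h1 (((roundState_snd_mono (K := K) n y (Nat.lt_succ_iff.1 h2)).trans_lt g2).le)
  have h4 : r ≤ u := by
    by_contra! hlt
    exact hu (idealSet_antitone n μ f T0 (Nat.le_add_left 1 u) hlt (h3 hir))
  exact Finset.mem_Ico.2 ⟨h1, by omega⟩

/-- On the event of small noise, arm `i` is pulled no more often than in the rounds `1, …, u`, if it
does not belong to `U_{u+1}`. -/
theorem playCount_le_of_noiseSmall [NeZero K] (hK : 2 ≤ K) (hn : 1 ≤ n) {μ : Fin K → ℝ} {f : ℝ → ℝ}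
    {L : ℝ≥0} {T0 : Fin K → ℝ} (hT0 : ∀ i, 1 ≤ T0 i)
    (hf : ∀ x ∈ Set.Ioc (0 : ℝ) 1, f x ∈ Set.Ioc (0 : ℝ) 1)
    (hf_mono : MonotoneOn f (Set.Ioc (0 : ℝ) 1))
    (hf_lip : LipschitzOnWith L f (Set.Ioc (0 : ℝ) 1))
    {D : ℝ} (hD : ∀ i j, T0 j - T0 i ≤ D) (hD0 : 0 ≤ D)
    {a : Fin K} (ha : ∀ j, μ j ≤ μ a) (ha0 : 0 ≤ μ a)
    (hgap : ∀ j, gap μ j = μ a - μ j)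
    (hlarge : μ a * (L : ℝ) / 2 ^ 5 * (1 + max ((1 + D / (K : ℝ)) *
          Real.log (1 + 2 ^ 8 * Real.log (12 / Real.pi ^ 2 * (K : ℝ) ^ 2 * (n : ℝ))))
        ((1 + D) * Real.log 13)) ≤ Real.log ((n : ℝ) * (K : ℝ)))
    {y : ℕ → ℝ} (hy : NoiseSmall n μ f T0 a y) {i : Fin K} {u : ℕ}
    (hu : i ∉ idealSet n μ f T0 (u + 1)) :
    (playCount (fun t => elimArm n y t) i n : ℝ) ≤ 4 ^ u / 16 * logFactor K n := by
  have hdrift : ∀ r, 1 ≤ r → ∀ i ∈ (roundState K n y r).1, ∀ j ∈ (roundState K n y r).1,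
      μ a * (avgReweight n f T0 r (roundState K n y r).1 (roundState K n y r).2 j -
        avgReweight n f T0 r (roundState K n y r).1 (roundState K n y r).2 i) ≤
          (1 / 2 : ℝ) ^ (r + 1) := fun r hr i hi j hj =>
    mul_avgReweight_sub_le hK hn hf_lip hT0 hD hD0 ha0 hlarge hr hi hj
      (card_mul_pullsBefore_le n y hr) (by rintro rfl; rfl)
  have h := playCount_le_of_subset_idealSet hn (μ := μ) (f := f) (T0 := T0) (y := y)
    (fun r hr hrn => (best_mem_and_subset_idealSet hn hT0 hf hf_mono ha hgap hy hdrift hr hrn).2.1)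
    hu
  obtain ⟨h1, h2⟩ := roundOf_le (K := K) hK hn y
  refine le_trans (by exact_mod_cast h) (pullsBefore_succ_le_of_le hK hn
    ((min_le_right _ _).trans h1) (min_le_left _ _) (le_trans ?_ h2))
  exact_mod_cast min_le_right _ _

end

/-! ### Measurability: the algorithm is non-anticipating -/

section

variable {K n : ℕ}

/-- The feedback sequence `y` with everything outside the times `1, …, t - 1` erased. -/
def pastFeedback (t : ℕ) (y : ℕ → ℝ) : ℕ → ℝ := fun s => if 1 ≤ s ∧ s < t then y s else 0

theorem roundState_update_zero (y : ℕ → ℝ) (x : ℝ) (r : ℕ) :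
    roundState K n (Function.update y 0 x) r = roundState K n y r := by
  have he : ∀ r S τ (i : Fin K), empMean n (Function.update y 0 x) r S τ i = empMean n y r S τ i :=
    -- a pull time is a successor, so that the update at `0` reduces definitionally
    fun _ _ _ _ => rfl
  match r with
  | 0 => rfl
  | 1 => rfl
  | r + 2 =>
    have ih := roundState_update_zero y x (r + 1)
    simp only [roundState]
    rw [ih]
    simp only [he]

theorem roundState_roundOf_pastFeedback [NeZero K] (hn : 1 ≤ n) (y : ℕ → ℝ) {t : ℕ} (ht : 1 ≤ t) :
    roundOf K n (pastFeedback t y) t = roundOf K n y t ∧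
      roundState K n (pastFeedback t y) (roundOf K n y t) = roundState K n y (roundOf K n y t) := by
  obtain ⟨g1, g2, g3⟩ := roundOf_spec (K := K) hn y ht
  have hst : roundState K n y (roundOf K n y t) =
      roundState K n (pastFeedback t y) (roundOf K n y t) := by
    rw [← roundState_update_zero y 0]
    refine roundState_congr K _ fun s hs => ?_
    rw [roundState_update_zero] at hs
    unfold pastFeedback
    rcases Nat.eq_zero_or_pos s with rfl | h
    · simp
    · rw [Function.update_of_ne h.ne', if_pos ⟨h, hs.trans_lt g2⟩]
  refine ⟨roundOf_eq (K := K) hn _ g1 (hst ▸ g2) ?_, hst.symm⟩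
  rw [roundState_succ_snd (K := K) n _ g1, ← hst, ← roundState_succ_snd (K := K) n y g1]
  exact g3

theorem measurable_empMean (r : ℕ) (S : Finset (Fin K)) (τ : ℕ) (i : Fin K) :
    Measurable fun y : ℕ → ℝ => empMean n y r S τ i := by
  unfold empMean
  fun_prop

theorem measurableSet_roundState_eq (r : ℕ) (x : Finset (Fin K) × ℕ) :
    MeasurableSet {y : ℕ → ℝ | roundState K n y r = x} := by
  match r with
  | 0 => exact MeasurableSet.const ((Finset.univ, 0) = x)
  | 1 => exact MeasurableSet.const ((Finset.univ, 0) = x)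
  | r + 2 =>
    have ih := fun p => measurableSet_roundState_eq (r + 1) p
    have : {y : ℕ → ℝ | roundState K n y (r + 2) = x} =
        ⋃ p : Finset (Fin K) × ℕ, {y : ℕ → ℝ | roundState K n y (r + 1) = p} ∩
          {y : ℕ → ℝ | (∀ i, (i ∈ p.1 ∧ ∀ j ∈ p.1,
            empMean n y (r + 1) p.1 p.2 j - empMean n y (r + 1) p.1 p.2 i ≤ (1 / 2 : ℝ) ^ (r + 1)) ↔
              i ∈ x.1) ∧ p.2 + p.1.card * pulls K n (r + 1) = x.2} := by
      ext y
      simp only [Set.mem_ofPred_eq, Set.mem_iUnion, Set.mem_inter_iff, exists_eq_left', roundState]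
      rw [Prod.ext_iff, Finset.ext_iff]
      simp only [Finset.mem_filter]
    rw [this]
    refine MeasurableSet.iUnion fun p => (ih p).inter (measurableSet_setOfPred.2
      (Measurable.and (Measurable.forall fun i => Measurable.iff (measurable_const.and
        (Measurable.forall fun j => measurable_const.imp ?_)) measurable_const) measurable_const))
    exact measurableSet_setOfPred.1 (measurableSet_le
      ((measurable_empMean _ _ _ _).sub (measurable_empMean _ _ _ _)) measurable_const)

theorem measurable_roundState (r : ℕ) :
    @Measurable _ _ _ ⊤ fun y : ℕ → ℝ => roundState K n y r := by
  let : MeasurableSpace (Finset (Fin K) × ℕ) := ⊤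
  exact measurable_to_countable' fun x => measurableSet_roundState_eq r x

theorem measurable_roundOf [NeZero K] (hn : 1 ≤ n) {t : ℕ} (ht : 1 ≤ t) :
    Measurable fun y : ℕ → ℝ => roundOf K n y t := by
  refine measurable_to_countable' fun r => ?_
  have : (fun y : ℕ → ℝ => roundOf K n y t) ⁻¹' {r} =
      {y | 1 ≤ r ∧ (roundState K n y r).2 < t ∧ t ≤ (roundState K n y (r + 1)).2} := by
    ext y
    simp only [Set.mem_preimage, Set.mem_singleton_iff, Set.mem_ofPred_eq]
    constructor
    · rintro rfl
      exact roundOf_spec hn y ht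
    · rintro ⟨h1, h2, h3⟩
      exact roundOf_eq hn y h1 h2 h3
  rw [this]
  refine (MeasurableSet.const (1 ≤ r)).inter (MeasurableSet.inter ?_ ?_)
  · exact (measurable_roundState r) (t := {p | p.2 < t}) trivial
  · exact (measurable_roundState (r + 1)) (t := {p | t ≤ p.2}) trivial

/-- The round and its state at time `t`, as a measurable function of the feedback sequence. -/
theorem measurable_roundState_roundOf [NeZero K] (hn : 1 ≤ n) {t : ℕ} (ht : 1 ≤ t) :
    @Measurable _ _ _ ⊤ fun y : ℕ → ℝ =>
      (roundOf K n y t, roundState K n y (roundOf K n y t)) := by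
  let : MeasurableSpace (ℕ × Finset (Fin K) × ℕ) := ⊤
  refine measurable_to_countable' fun p => ?_
  have : (fun y : ℕ → ℝ => (roundOf K n y t, roundState K n y (roundOf K n y t))) ⁻¹' {p} =
      {y | roundOf K n y t = p.1} ∩ {y | roundState K n y p.1 = p.2} := by
    ext y
    simp only [Set.mem_preimage, Set.mem_singleton_iff, Set.mem_inter_iff, Set.mem_ofPred_eq,
      Prod.ext_iff (y := p)]
    constructor
    · rintro ⟨h1, h2⟩
      exact ⟨h1, h1 ▸ h2⟩
    · rintro ⟨h1, h2⟩
      exact ⟨h1, h1.symm ▸ h2⟩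
  rw [this]
  exact (measurable_roundOf hn ht (measurableSet_singleton p.1)).inter
    (measurableSet_roundState_eq _ _)

variable {Ω : Type*}

theorem measurable_prodMk_history (A : ℕ → Ω → Fin K) (Y : ℕ → Ω → ℝ) {s t : ℕ} (hs : 1 ≤ s)
    (hst : s ≤ t) : Measurable[history A Y t] fun ω => (A s ω, Y s ω) := by
  have h : MeasurableSpace.comap (fun ω => (A s ω, Y s ω)) inferInstance ≤ history A Y t :=
    le_iSup₂_of_le (f := fun s (_ : s ∈ Finset.Icc 1 t) =>
      MeasurableSpace.comap (fun ω => (A s ω, Y s ω)) inferInstance) s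
      (Finset.mem_Icc.2 ⟨hs, hst⟩) le_rfl
  exact (comap_measurable _).mono h le_rfl

theorem measurable_feedback_history (A : ℕ → Ω → Fin K) (Y : ℕ → Ω → ℝ) {s t : ℕ} (hs : 1 ≤ s)
    (hst : s ≤ t) : Measurable[history A Y t] (Y s) :=
  measurable_snd.comp (measurable_prodMk_history A Y hs hst)

theorem history_mono (A : ℕ → Ω → Fin K) (Y : ℕ → Ω → ℝ) {s t : ℕ} (hst : s ≤ t) :
    history A Y s ≤ history A Y t :=
  biSup_mono fun _ h => Finset.Icc_subset_Icc_right hst h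

theorem measurable_pastFeedback (A : ℕ → Ω → Fin K) (Y : ℕ → Ω → ℝ) (t : ℕ) :
    Measurable[history A Y (t - 1)] fun ω => pastFeedback t fun s => Y s ω := by
  refine @measurable_pi_lambda _ _ _ (history A Y (t - 1)) _ _ fun s => ?_
  unfold pastFeedback
  by_cases h : 1 ≤ s ∧ s < t
  · simp only [h, and_self, if_true]
    exact measurable_feedback_history A Y h.1 (by omega)
  · simp only [h, if_false]
    exact @measurable_const _ _ _ (history A Y (t - 1)) _

/-- Whatever is a function of the current round and of its state is known before the current
feedback. -/
theorem measurable_comp_roundState_roundOf [NeZero K] (hn : 1 ≤ n) (A : ℕ → Ω → Fin K)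
    (Y : ℕ → Ω → ℝ) {t : ℕ} (ht : 1 ≤ t) {β : Type*} [MeasurableSpace β]
    (g : ℕ × Finset (Fin K) × ℕ → β) :
    Measurable[history A Y (t - 1)] fun ω => g (roundOf K n (fun s => Y s ω) t,
      roundState K n (fun s => Y s ω) (roundOf K n (fun s => Y s ω) t)) := by
  let : MeasurableSpace (ℕ × Finset (Fin K) × ℕ) := ⊤
  have hg : Measurable g := fun _ _ => trivial
  have h := (hg.comp (measurable_roundState_roundOf (K := K) hn ht)).comp
    (measurable_pastFeedback A Y t)
  convert h using 2 with ω
  obtain ⟨h1, h2⟩ := roundState_roundOf_pastFeedback (K := K) hn (fun s => Y s ω) ht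
  simp only [Function.comp_apply]
  rw [h1, h2]

theorem measurable_elimArm [NeZero K] (hn : 1 ≤ n) (A : ℕ → Ω → Fin K)
    (Y : ℕ → Ω → ℝ) {t : ℕ} (ht : 1 ≤ t) :
    Measurable[history A Y (t - 1)] fun ω => (elimArm n (fun s => Y s ω) t : Fin K) :=
  measurable_comp_roundState_roundOf hn A Y ht fun p =>
    (p.2.1.sort (fun i j => i ≤ j)).getD ((t - 1 - p.2.2) % p.2.1.card) 0

theorem history_le [m0 : MeasurableSpace Ω] [NeZero K] (hn : 1 ≤ n) {A : ℕ → Ω → Fin K}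
    {Y : ℕ → Ω → ℝ} (hA : ∀ t ω, A t ω = elimArm n (fun s => Y s ω) t)
    (hY : ∀ t ∈ Finset.Icc 1 n, Measurable (Y t)) {t : ℕ} (ht : t ≤ n) : history A Y t ≤ m0 := by
  induction t with
  | zero => simp [history]
  | succ t ih =>
    have ih := ih (by omega)
    refine iSup₂_le fun s hs => ?_
    obtain ⟨h1, h2⟩ := Finset.mem_Icc.1 hs
    refine Measurable.comap_le (Measurable.prodMk ?_ (hY s (Finset.mem_Icc.2 ⟨h1, by omega⟩)))
    have h := measurable_elimArm hn A Y h1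
    have e : A s = fun ω => elimArm n (fun s => Y s ω) s := funext (hA s)
    rw [e]
    exact h.mono ((history_mono A Y (by omega)).trans ih) le_rfl

theorem measurable_arm [m0 : MeasurableSpace Ω] [NeZero K] (hn : 1 ≤ n) {A : ℕ → Ω → Fin K}
    {Y : ℕ → Ω → ℝ} (hA : ∀ t ω, A t ω = elimArm n (fun s => Y s ω) t)
    (hY : ∀ t ∈ Finset.Icc 1 n, Measurable (Y t)) : ∀ t ∈ Finset.Icc 1 n, Measurable (A t) := by
  intro t ht
  obtain ⟨h1, h2⟩ := Finset.mem_Icc.1 ht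
  rw [show A t = fun ω => elimArm n (fun s => Y s ω) t from funext (hA t)]
  exact (measurable_elimArm hn A Y h1).mono (history_le hn hA hY (by omega)) le_rfl

end

/-! ### Concentration for predictable sums of conditionally subgaussian variables -/

section

variable {Ω : Type*} [m0 : MeasurableSpace Ω] {P : Measure Ω} [IsProbabilityMeasure P]

/-- A bound on a conditional expectation may be used under the integral against any nonnegative
weight that is measurable for the conditioning σ-algebra; no integrability of the product is
needed. -/
theorem lintegral_mul_ofReal_le_of_condExp_le {m : MeasurableSpace Ω} (hm : m ≤ m0) {g : Ω → ℝ}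
    (hg : Integrable g P) (hg0 : ∀ ω, 0 ≤ g ω) {C : ℝ} (hC : 0 ≤ C)
    (h : P[g | m] ≤ᵐ[P] fun _ => C) {W : Ω → ENNReal} (hW : Measurable[m] W) :
    ∫⁻ ω, W ω * ENNReal.ofReal (g ω) ∂P ≤ ∫⁻ ω, W ω * ENNReal.ofReal C ∂P := by
  have hgm : AEMeasurable (fun ω => ENNReal.ofReal (g ω)) P :=
    hg.aestronglyMeasurable.aemeasurable.ennreal_ofReal
  have hle : (P.withDensity fun ω => ENNReal.ofReal (g ω)).trim hm ≤
      (ENNReal.ofReal C • P).trim hm := by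
    refine Measure.le_iff.2 fun s hs => ?_
    rw [trim_measurableSet_eq hm hs, trim_measurableSet_eq hm hs, withDensity_apply _ (hm s hs),
      ← ofReal_integral_eq_lintegral_ofReal hg.integrableOn (ae_of_all _ hg0),
      ← setIntegral_condExp hm hg hs, Measure.smul_apply, smul_eq_mul]
    calc ENNReal.ofReal (∫ ω in s, (P[g | m]) ω ∂P)
        ≤ ENNReal.ofReal (∫ _ in s, C ∂P) :=
          ENNReal.ofReal_le_ofReal (setIntegral_mono_ae integrable_condExp.integrableOn
            (integrable_const C).integrableOn h)
      _ = ENNReal.ofReal C * P s := by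
          rw [setIntegral_const, smul_eq_mul, mul_comm, ENNReal.ofReal_mul hC, ofReal_measureReal]
  calc ∫⁻ ω, W ω * ENNReal.ofReal (g ω) ∂P
      = ∫⁻ ω, W ω ∂(P.withDensity fun ω => ENNReal.ofReal (g ω)) := by
        rw [lintegral_withDensity_eq_lintegral_mul₀ hgm (hW.mono hm le_rfl).aemeasurable]
        simp only [Pi.mul_apply, mul_comm]
    _ = ∫⁻ ω, W ω ∂((P.withDensity fun ω => ENNReal.ofReal (g ω)).trim hm) :=
        (lintegral_trim hm hW).symm
    _ ≤ ∫⁻ ω, W ω ∂((ENNReal.ofReal C • P).trim hm) := lintegral_mono' hle le_rfl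
    _ = ∫⁻ ω, W ω ∂(ENNReal.ofReal C • P) := lintegral_trim hm hW
    _ = ∫⁻ ω, W ω * ENNReal.ofReal C ∂P := by
        rw [lintegral_smul_measure, smul_eq_mul, mul_comm,
          lintegral_mul_const _ (hW.mono hm le_rfl)]

theorem lintegral_mul_exp_le {m : MeasurableSpace Ω} (hm : m ≤ m0) {η : Ω → ℝ}
    (hη : Measurable[m0] η)
    (hsub : ∀ v : ℝ, Integrable (fun ω => Real.exp (v * η ω)) P ∧
      P[fun ω => Real.exp (v * η ω) | m] ≤ᵐ[P] fun _ => Real.exp (v ^ 2 / 2))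
    {V : Finset ℝ} {c : Ω → ℝ} (hc : Measurable[m] c) (hcV : ∀ ω, c ω ∈ V)
    {W : Ω → ENNReal} (hW : Measurable[m] W) :
    ∫⁻ ω, W ω * ENNReal.ofReal (Real.exp (c ω * η ω - c ω ^ 2 / 2)) ∂P ≤ ∫⁻ ω, W ω ∂P := by
  -- on each level set of `c` the weight is a constant
  set U : ℝ → Ω → ENNReal := fun v => {ω | c ω = v}.indicator
    (fun ω => W ω * ENNReal.ofReal (Real.exp (-(v ^ 2 / 2)))) with hU
  have hUm : ∀ v, Measurable[m] (U v) := fun v =>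
    Measurable.indicator (hW.mul_const _) (hc (measurableSet_singleton v))
  have hsum : ∀ (φ : ℝ → ENNReal) (ω : Ω), ∑ v ∈ V, U v ω * φ v =
      W ω * ENNReal.ofReal (Real.exp (-(c ω ^ 2 / 2))) * φ (c ω) := by
    intro φ ω
    rw [Finset.sum_eq_single (c ω)]
    · rw [hU]
      simp only [Set.indicator_apply, Set.mem_ofPred_eq, if_true]
    · intro v _ hv
      rw [hU]
      simp only [Set.indicator_apply, Set.mem_ofPred_eq, if_neg hv.symm, zero_mul]
    · exact fun h => absurd (hcV ω) h
  calc ∫⁻ ω, W ω * ENNReal.ofReal (Real.exp (c ω * η ω - c ω ^ 2 / 2)) ∂P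
      = ∫⁻ ω, ∑ v ∈ V, U v ω * ENNReal.ofReal (Real.exp (v * η ω)) ∂P := by
        refine lintegral_congr fun ω => ?_
        rw [hsum (fun v => ENNReal.ofReal (Real.exp (v * η ω))), mul_assoc,
          ← ENNReal.ofReal_mul (Real.exp_nonneg _), ← Real.exp_add]
        congr 3
        ring
    _ = ∑ v ∈ V, ∫⁻ ω, U v ω * ENNReal.ofReal (Real.exp (v * η ω)) ∂P :=
        lintegral_finsetSum V fun v _ => ((hUm v).mono hm le_rfl).mul
          (Real.measurable_exp.comp (hη.const_mul v)).ennreal_ofReal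
    _ ≤ ∑ v ∈ V, ∫⁻ ω, U v ω * ENNReal.ofReal (Real.exp (v ^ 2 / 2)) ∂P :=
        Finset.sum_le_sum fun v _ => lintegral_mul_ofReal_le_of_condExp_le (m0 := m0) hm (hsub v).1
          (fun _ => Real.exp_nonneg _) (Real.exp_nonneg _) (hsub v).2 (hUm v)
    _ = ∫⁻ ω, ∑ v ∈ V, U v ω * ENNReal.ofReal (Real.exp (v ^ 2 / 2)) ∂P :=
        (lintegral_finsetSum V fun v _ => ((hUm v).mono hm le_rfl).mul_const _).symm
    _ = ∫⁻ ω, W ω ∂P := by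
        refine lintegral_congr fun ω => ?_
        rw [hsum (fun v => ENNReal.ofReal (Real.exp (v ^ 2 / 2))), mul_assoc,
          ← ENNReal.ofReal_mul (Real.exp_nonneg _), ← Real.exp_add]
        simp

/-- The exponential supermartingale of a predictable transform of conditionally subgaussian
increments. -/
theorem lintegral_exp_sum_le_one {ℱ : ℕ → MeasurableSpace Ω} {n : ℕ} (hmono : Monotone ℱ)
    (hle : ∀ t ≤ n, ℱ t ≤ m0) {η : ℕ → Ω → ℝ} (hη : ∀ t ∈ Finset.Icc 1 n, Measurable[ℱ t] (η t))
    (hsub : ∀ t ∈ Finset.Icc 1 n, ∀ v : ℝ, Integrable (fun ω => Real.exp (v * η t ω)) P ∧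
      P[fun ω => Real.exp (v * η t ω) | ℱ (t - 1)] ≤ᵐ[P] fun _ => Real.exp (v ^ 2 / 2))
    {V : Finset ℝ} {c : ℕ → Ω → ℝ} (hc : ∀ t ∈ Finset.Icc 1 n, Measurable[ℱ (t - 1)] (c t))
    (hcV : ∀ t ω, c t ω ∈ V) {T : ℕ} (hT : T ≤ n) :
    ∫⁻ ω, ENNReal.ofReal (Real.exp (∑ t ∈ Finset.Icc 1 T, (c t ω * η t ω - c t ω ^ 2 / 2))) ∂P
      ≤ 1 := by
  induction T with
  | zero => simp
  | succ T ih =>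
    have hmem : T + 1 ∈ Finset.Icc 1 n := Finset.mem_Icc.2 ⟨by omega, hT⟩
    have hW : Measurable[ℱ T] fun ω => ENNReal.ofReal
        (Real.exp (∑ t ∈ Finset.Icc 1 T, (c t ω * η t ω - c t ω ^ 2 / 2))) := by
      refine (Real.measurable_exp.comp (Finset.measurable_fun_sum _ fun t ht => ?_)).ennreal_ofReal
      obtain ⟨h1, h2⟩ := Finset.mem_Icc.1 ht
      have ht' : t ∈ Finset.Icc 1 n := Finset.mem_Icc.2 ⟨h1, by omega⟩
      have h3 : Measurable[ℱ T] (c t) := (hc t ht').mono (hmono (by omega)) le_rfl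
      have h4 : Measurable[ℱ T] (η t) := (hη t ht').mono (hmono h2) le_rfl
      exact (h3.mul h4).sub ((h3.pow_const 2).div_const 2)
    refine le_trans (le_of_eq ?_) ((lintegral_mul_exp_le (hle T (by omega))
      ((hη _ hmem).mono (hle _ hT) le_rfl) (hsub _ hmem) (hc _ hmem) (hcV (T + 1)) hW).trans
        (ih (by omega)))
    refine lintegral_congr fun ω => ?_
    rw [Finset.sum_Icc_succ_top (by omega), Real.exp_add, ENNReal.ofReal_mul (Real.exp_nonneg _)]

theorem measure_le_exp_of_le_sum {ℱ : ℕ → MeasurableSpace Ω} {n : ℕ} (hmono : Monotone ℱ)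
    (hle : ∀ t ≤ n, ℱ t ≤ m0) {η : ℕ → Ω → ℝ} (hη : ∀ t ∈ Finset.Icc 1 n, Measurable[ℱ t] (η t))
    (hsub : ∀ t ∈ Finset.Icc 1 n, ∀ v : ℝ, Integrable (fun ω => Real.exp (v * η t ω)) P ∧
      P[fun ω => Real.exp (v * η t ω) | ℱ (t - 1)] ≤ᵐ[P] fun _ => Real.exp (v ^ 2 / 2))
    {V : Finset ℝ} {c : ℕ → Ω → ℝ} (hc : ∀ t ∈ Finset.Icc 1 n, Measurable[ℱ (t - 1)] (c t))
    (hcV : ∀ t ω, c t ω ∈ V) {E : Set Ω} {x : ℝ}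
    (hE : ∀ ω ∈ E, x ≤ ∑ t ∈ Finset.Icc 1 n, (c t ω * η t ω - c t ω ^ 2 / 2)) :
    P E ≤ ENNReal.ofReal (Real.exp (-x)) := by
  have h1 := lintegral_exp_sum_le_one hmono hle hη hsub hc hcV le_rfl
  have hmeas : Measurable fun ω => ENNReal.ofReal
      (Real.exp (∑ t ∈ Finset.Icc 1 n, (c t ω * η t ω - c t ω ^ 2 / 2))) := by
    refine (Real.measurable_exp.comp (Finset.measurable_fun_sum _ fun t ht => ?_)).ennreal_ofReal
    obtain ⟨h1, h2⟩ := Finset.mem_Icc.1 ht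
    have h3 : Measurable (c t) := (hc t ht).mono (hle _ (by omega)) le_rfl
    have h4 : Measurable (η t) := (hη t ht).mono (hle _ h2) le_rfl
    exact (h3.mul h4).sub ((h3.pow_const 2).div_const 2)
  have h2 := (mul_meas_ge_le_lintegral hmeas (ENNReal.ofReal (Real.exp x)) (μ := P)).trans h1
  have h3 : P E ≤ P {ω | ENNReal.ofReal (Real.exp x) ≤ ENNReal.ofReal
      (Real.exp (∑ t ∈ Finset.Icc 1 n, (c t ω * η t ω - c t ω ^ 2 / 2)))} :=
    measure_mono fun ω hω => ENNReal.ofReal_le_ofReal (Real.exp_le_exp.2 (hE ω hω))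
  rw [Real.exp_neg, ENNReal.ofReal_inv_of_pos (Real.exp_pos x)]
  refine h3.trans ?_
  rw [← one_div, ENNReal.le_div_iff_mul_le
    (Or.inl (ENNReal.ofReal_pos.2 (Real.exp_pos x)).ne') (Or.inl ENNReal.ofReal_ne_top), mul_comm]
  exact h2

end

/-! ### The noise is small with high probability -/

section

variable {K n : ℕ}

/-- `1` at the times of round `r` at which arm `j` is pulled, `-1` at those at which arm `a` is
pulled, provided that both are active in that round, and `0` otherwise. -/
def pairWeight [NeZero K] (n r : ℕ) (j a : Fin K) (y : ℕ → ℝ) (t : ℕ) : ℝ :=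
  if roundOf K n y t = r ∧ j ∈ (roundState K n y (roundOf K n y t)).1 ∧
      a ∈ (roundState K n y (roundOf K n y t)).1 then
    (if elimArm n y t = j then 1 else 0) - (if elimArm n y t = a then 1 else 0)
  else 0

theorem pairWeight_mem [NeZero K] (n r : ℕ) (j a : Fin K) (y : ℕ → ℝ) (t : ℕ) :
    pairWeight n r j a y t ∈ ({1, 0, -1} : Finset ℝ) := by
  unfold pairWeight
  split_ifs <;> simp

theorem measurable_pairWeight [NeZero K] (hn : 1 ≤ n) {Ω : Type*} (A : ℕ → Ω → Fin K)
    (Y : ℕ → Ω → ℝ) (r : ℕ) (j a : Fin K) {t : ℕ} (ht : 1 ≤ t) :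
    Measurable[history A Y (t - 1)] fun ω => pairWeight n r j a (fun s => Y s ω) t :=
  measurable_comp_roundState_roundOf hn A Y ht fun p =>
    if p.1 = r ∧ j ∈ p.2.1 ∧ a ∈ p.2.1 then
      (if (p.2.1.sort (fun i j => i ≤ j)).getD ((t - 1 - p.2.2) % p.2.1.card) 0 = j
        then (1 : ℝ) else 0) -
      (if (p.2.1.sort (fun i j => i ≤ j)).getD ((t - 1 - p.2.2) % p.2.1.card) 0 = a then 1 else 0)
    else 0

theorem sum_ite_round_arm [NeZero K] (hn : 1 ≤ n) (y : ℕ → ℝ) {r : ℕ} (hr : 1 ≤ r)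
    {i : Fin K} (hi : i ∈ (roundState K n y r).1) (hT : (roundState K n y (r + 1)).2 ≤ n)
    (φ : ℕ → ℝ) :
    ∑ t ∈ Finset.Icc 1 n, (if roundOf K n y t = r ∧ elimArm n y t = i then φ t else 0) =
      ∑ ℓ ∈ Finset.Icc 1 (pulls K n r),
        φ (pullTime (roundState K n y r).1 (roundState K n y r).2 i ℓ) := by
  rw [← Finset.sum_filter, filter_round_eq_image hn y hr hi hT,
    Finset.sum_image (pullTime_injOn _ hi _)]

theorem sum_pairWeight_mul [NeZero K] (hn : 1 ≤ n) (y : ℕ → ℝ) {r : ℕ} (hr : 1 ≤ r)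
    {j a : Fin K} (hj : j ∈ (roundState K n y r).1) (ha : a ∈ (roundState K n y r).1)
    (hT : (roundState K n y (r + 1)).2 ≤ n) (φ : ℕ → ℝ) :
    ∑ t ∈ Finset.Icc 1 n, pairWeight n r j a y t * φ t =
      ∑ ℓ ∈ Finset.Icc 1 (pulls K n r),
        φ (pullTime (roundState K n y r).1 (roundState K n y r).2 j ℓ) -
      ∑ ℓ ∈ Finset.Icc 1 (pulls K n r),
        φ (pullTime (roundState K n y r).1 (roundState K n y r).2 a ℓ) := by
  rw [← sum_ite_round_arm hn y hr hj hT, ← sum_ite_round_arm hn y hr ha hT,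
    ← Finset.sum_sub_distrib]
  refine Finset.sum_congr rfl fun t _ => ?_
  unfold pairWeight
  by_cases h : roundOf K n y t = r
  · simp only [h, hj, ha, true_and, and_self, if_true]
    split_ifs <;> ring
  · simp [h]

theorem sum_pairWeight_sq_le [NeZero K] (hn : 1 ≤ n) (y : ℕ → ℝ) {r : ℕ} (hr : 1 ≤ r)
    {j a : Fin K} (hj : j ∈ (roundState K n y r).1) (ha : a ∈ (roundState K n y r).1)
    (hT : (roundState K n y (r + 1)).2 ≤ n) :
    ∑ t ∈ Finset.Icc 1 n, pairWeight n r j a y t ^ 2 ≤ 2 * pulls K n r := by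
  have h1 := sum_ite_round_arm hn y hr hj hT fun _ => 1
  have h2 := sum_ite_round_arm hn y hr ha hT fun _ => 1
  have e : ∑ ℓ ∈ Finset.Icc 1 (pulls K n r), (1 : ℝ) = pulls K n r := by simp
  rw [e] at h1 h2
  rw [two_mul]
  nth_rewrite 1 [← h1]
  rw [← h2, ← Finset.sum_add_distrib]
  refine Finset.sum_le_sum fun t _ => ?_
  unfold pairWeight
  by_cases h : roundOf K n y t = r
  · simp only [h, hj, ha, true_and, and_self, if_true]
    split_ifs <;> norm_num
  · simp [h]

variable {Ω : Type*} [m0 : MeasurableSpace Ω] {P : Measure Ω}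

/-- The deviation of the feedback at time `t` from its conditional mean. -/
def noise (P : Measure Ω) (A : ℕ → Ω → Fin K) (Y : ℕ → Ω → ℝ) (t : ℕ) (ω : Ω) : ℝ :=
  Y t ω - (P[Y t | history A Y (t - 1)]) ω

theorem sum_noise_div_eq [NeZero K] (hn : 1 ≤ n) {μ : Fin K → ℝ} {f : ℝ → ℝ} {T0 : Fin K → ℝ}
    {Y : ℕ → Ω → ℝ} {A : ℕ → Ω → Fin K} (hA : ∀ t ω, A t ω = elimArm n (fun s => Y s ω) t) {ω : Ω}
    (hω : ∀ t ∈ Finset.Icc 1 n, (P[Y t | history A Y (t - 1)]) ω =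
      μ (A t ω) * f (fraction T0 (fun s => A s ω) (A t ω) t))
    {r : ℕ} (hr : 1 ≤ r) (hrn : (roundState K n (fun s => Y s ω) (r + 1)).2 ≤ n) {i : Fin K}
    (hi : i ∈ (roundState K n (fun s => Y s ω) r).1) :
    ∑ ℓ ∈ Finset.Icc 1 (pulls K n r), noise P A Y (pullTime
        (roundState K n (fun s => Y s ω) r).1 (roundState K n (fun s => Y s ω) r).2 i ℓ) ω =
      pulls K n r * (empMean n (fun s => Y s ω) r (roundState K n (fun s => Y s ω) r).1
          (roundState K n (fun s => Y s ω) r).2 i -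
        μ i * avgReweight n f T0 r (roundState K n (fun s => Y s ω) r).1
          (roundState K n (fun s => Y s ω) r).2 i) := by
  have hm : (pulls K n r : ℝ) ≠ 0 := by
    have := pulls_pos (K := K) hn hr
    positivity
  unfold empMean avgReweight
  rw [← mul_div_assoc, ← sub_div, mul_div_cancel₀ _ hm, Finset.mul_sum, ← Finset.sum_sub_distrib]
  refine Finset.sum_congr rfl fun ℓ hℓ => ?_
  have h1 := lt_pullTime (roundState K n (fun s => Y s ω) r).1
    (roundState K n (fun s => Y s ω) r).2 i ℓ
  have h2 := pullTime_le (τ := (roundState K n (fun s => Y s ω) r).2) hi hℓ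
  rw [← roundState_succ_snd n _ hr] at h2
  unfold noise
  rw [hω _ (Finset.mem_Icc.2 ⟨by omega, by omega⟩), hA, elimArm_pullTime hn _ hr hi hℓ]
  simp only [hA]
  rw [fraction_pullTime hn T0 _ hr hi hℓ]

/-- The exponent in the tail bound for the difference of two empirical means in round `r`. -/
theorem log_le_pulls_mul (hK : 2 ≤ K) (hn : 1 ≤ n) {r : ℕ} (hr : 1 ≤ r) :
    2 * Real.log ((K : ℝ) ^ 2 * n) ≤ pulls K n r * ((1 / 2 : ℝ) ^ (r + 2)) ^ 2 := by
  have h := two_pow_mul_log_le_pulls hK hn hr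
  have e : (2 : ℝ) ^ (2 * r + 5) * ((1 / 2 : ℝ) ^ (r + 2)) ^ 2 = 2 := by
    rw [← pow_mul, show 2 * r + 5 = (r + 2) * 2 + 1 by ring, pow_succ (2 : ℝ), mul_right_comm,
      ← mul_pow]
    norm_num
  calc 2 * Real.log ((K : ℝ) ^ 2 * n)
      = 2 ^ (2 * r + 5) * Real.log ((K : ℝ) ^ 2 * n) * ((1 / 2 : ℝ) ^ (r + 2)) ^ 2 := by
        rw [mul_right_comm, e]
    _ ≤ _ := by gcongr

theorem measure_pair_deviation_le [IsProbabilityMeasure P] [NeZero K] (hK : 2 ≤ K)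
    (hn : 1 ≤ n) {μ : Fin K → ℝ}
    {f : ℝ → ℝ} {T0 : Fin K → ℝ} {Y : ℕ → Ω → ℝ} {A : ℕ → Ω → Fin K}
    (hA : ∀ t ω, A t ω = elimArm n (fun s => Y s ω) t)
    (hY : IsBiasedFeedback P n μ f T0 A Y) {r : ℕ} (hr : 1 ≤ r) (j a : Fin K) {σ : ℝ}
    (hσ : σ ^ 2 = 1) :
    P {ω | (∀ t ∈ Finset.Icc 1 n, (P[Y t | history A Y (t - 1)]) ω =
          μ (A t ω) * f (fraction T0 (fun s => A s ω) (A t ω) t)) ∧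
        (roundState K n (fun s => Y s ω) (r + 1)).2 ≤ n ∧
        a ∈ (roundState K n (fun s => Y s ω) r).1 ∧ j ∈ (roundState K n (fun s => Y s ω) r).1 ∧
        (1 / 2 : ℝ) ^ (r + 1) ≤ σ *
          ((empMean n (fun s => Y s ω) r (roundState K n (fun s => Y s ω) r).1
              (roundState K n (fun s => Y s ω) r).2 j -
            μ j * avgReweight n f T0 r (roundState K n (fun s => Y s ω) r).1
              (roundState K n (fun s => Y s ω) r).2 j) -
          (empMean n (fun s => Y s ω) r (roundState K n (fun s => Y s ω) r).1
              (roundState K n (fun s => Y s ω) r).2 a -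
            μ a * avgReweight n f T0 r (roundState K n (fun s => Y s ω) r).1
              (roundState K n (fun s => Y s ω) r).2 a))} ≤
      ENNReal.ofReal (Real.exp (-(2 * Real.log ((K : ℝ) ^ 2 * n)))) := by
  -- the value that minimises the exponent `c² m - c m (1/2)^(r+1)`
  set c : ℝ := (1 / 2 : ℝ) ^ (r + 2) with hc
  have hle : ∀ t ≤ n, history A Y t ≤ m0 := fun t ht => history_le hn hA hY.measurable ht
  refine measure_le_exp_of_le_sum (ℱ := history A Y) (n := n) (η := noise P A Y)
    (c := fun t ω => σ * c * pairWeight n r j a (fun s => Y s ω) t)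
    (V := ({1, 0, -1} : Finset ℝ).image fun x => σ * c * x)
    (fun _ _ h => history_mono A Y h) hle (fun t ht => ?_) hY.subgaussian (fun t ht => ?_)
    (fun t ω => Finset.mem_image_of_mem _ (pairWeight_mem n r j a _ t)) ?_
  · obtain ⟨h1, h2⟩ := Finset.mem_Icc.1 ht
    exact (measurable_feedback_history A Y h1 le_rfl).sub
      (stronglyMeasurable_condExp.measurable.mono (history_mono A Y (by omega)) le_rfl)
  · exact (measurable_pairWeight hn A Y r j a (Finset.mem_Icc.1 ht).1).const_mul _
  · rintro ω ⟨hω, hrn, ha, hj, hdev⟩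
    have hsq := sum_pairWeight_sq_le hn (fun s => Y s ω) hr hj ha hrn
    have hlin := sum_pairWeight_mul hn (fun s => Y s ω) hr hj ha hrn fun t => noise P A Y t ω
    rw [sum_noise_div_eq hn hA hω hr hrn hj, sum_noise_div_eq hn hA hω hr hrn ha, ← mul_sub] at hlin
    have hm : (0 : ℝ) ≤ pulls K n r := Nat.cast_nonneg _
    have hc0 : 0 ≤ c := by positivity
    have hc2 : (1 / 2 : ℝ) ^ (r + 1) = 2 * c := by rw [hc, pow_succ _ (r + 1)]; ring
    rw [hc2] at hdev
    have e : ∑ t ∈ Finset.Icc 1 n,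
        (σ * c * pairWeight n r j a (fun s => Y s ω) t * noise P A Y t ω -
        (σ * c * pairWeight n r j a (fun s => Y s ω) t) ^ 2 / 2) =
        σ * c * ∑ t ∈ Finset.Icc 1 n, pairWeight n r j a (fun s => Y s ω) t * noise P A Y t ω -
        c ^ 2 / 2 * ∑ t ∈ Finset.Icc 1 n, pairWeight n r j a (fun s => Y s ω) t ^ 2 := by
      rw [Finset.sum_sub_distrib, Finset.mul_sum, Finset.mul_sum]
      congr 1
      · exact Finset.sum_congr rfl fun t _ => by ring
      · refine Finset.sum_congr rfl fun t _ => ?_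
        rw [mul_pow, mul_pow, hσ]; ring
    rw [e, hlin]
    have h1 := mul_le_mul_of_nonneg_left hdev (mul_nonneg hc0 hm)
    have h2 := mul_le_mul_of_nonneg_left hsq (show 0 ≤ c ^ 2 / 2 by positivity)
    have h3 := log_le_pulls_mul hK hn hr
    rw [← hc] at h3
    linarith

theorem measure_not_noiseSmall_le [IsProbabilityMeasure P] [NeZero K] (hK : 2 ≤ K)
    (hn : 1 ≤ n) {μ : Fin K → ℝ}
    {f : ℝ → ℝ} {T0 : Fin K → ℝ} {Y : ℕ → Ω → ℝ} {A : ℕ → Ω → Fin K}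
    (hA : ∀ t ω, A t ω = elimArm n (fun s => Y s ω) t)
    (hY : IsBiasedFeedback P n μ f T0 A Y) (a : Fin K) :
    P {ω | ¬ NoiseSmall n μ f T0 a fun s => Y s ω} ≤ ENNReal.ofReal (1 / n) := by
  set B : ℕ → Fin K → ℝ → Set Ω := fun r j σ =>
    {ω | (∀ t ∈ Finset.Icc 1 n, (P[Y t | history A Y (t - 1)]) ω =
          μ (A t ω) * f (fraction T0 (fun s => A s ω) (A t ω) t)) ∧
        (roundState K n (fun s => Y s ω) (r + 1)).2 ≤ n ∧
        a ∈ (roundState K n (fun s => Y s ω) r).1 ∧ j ∈ (roundState K n (fun s => Y s ω) r).1 ∧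
        (1 / 2 : ℝ) ^ (r + 1) ≤ σ *
          ((empMean n (fun s => Y s ω) r (roundState K n (fun s => Y s ω) r).1
              (roundState K n (fun s => Y s ω) r).2 j -
            μ j * avgReweight n f T0 r (roundState K n (fun s => Y s ω) r).1
              (roundState K n (fun s => Y s ω) r).2 j) -
          (empMean n (fun s => Y s ω) r (roundState K n (fun s => Y s ω) r).1
              (roundState K n (fun s => Y s ω) r).2 a -
            μ a * avgReweight n f T0 r (roundState K n (fun s => Y s ω) r).1
              (roundState K n (fun s => Y s ω) r).2 a))} with hB
  have hmodel : ∀ᵐ ω ∂P, ∀ t ∈ Finset.Icc 1 n, (P[Y t | history A Y (t - 1)]) ω =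
      μ (A t ω) * f (fraction T0 (fun s => A s ω) (A t ω) t) :=
    (Finset.eventually_all _).2 hY.condExp_eq
  have hcover : ({ω | ¬ NoiseSmall n μ f T0 a fun s => Y s ω} : Set Ω) ≤ᵐ[P]
      (⋃ p ∈ Finset.Icc 1 n ×ˢ (Finset.univ : Finset (Fin K)) ×ˢ ({1, -1} : Finset ℝ),
        B p.1 p.2.1 p.2.2 : Set Ω) := by
    filter_upwards [hmodel] with ω hω hbad
    change ¬ NoiseSmall n μ f T0 a (fun s => Y s ω) at hbad
    unfold NoiseSmall at hbad
    push Not at hbad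
    obtain ⟨r, hr, hrn, ha, j, hj, hdev⟩ := hbad
    have hrle : r ≤ n := (le_roundState_snd hn _ r).trans hrn
    rcases lt_abs.1 hdev with h | h
    · refine Set.mem_iUnion₂.2 ⟨(r, j, 1), by simp [hr, hrle], hω, hrn, ha, hj, ?_⟩
      rw [one_mul]; exact h.le
    · refine Set.mem_iUnion₂.2 ⟨(r, j, -1), by simp [hr, hrle], hω, hrn, ha, hj, ?_⟩
      rw [neg_one_mul]; exact h.le
  have hK' : (2 : ℝ) ≤ K := by exact_mod_cast hK
  have hn' : (1 : ℝ) ≤ n := by exact_mod_cast hn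
  have hexp : Real.exp (-(2 * Real.log ((K : ℝ) ^ 2 * n))) = 1 / ((K : ℝ) ^ 2 * n) ^ 2 := by
    rw [Real.exp_neg, mul_comm, Real.exp_mul, Real.exp_log (by positivity), one_div]
    norm_cast
  calc P {ω | ¬ NoiseSmall n μ f T0 a fun s => Y s ω}
      ≤ P (⋃ p ∈ Finset.Icc 1 n ×ˢ (Finset.univ : Finset (Fin K)) ×ˢ ({1, -1} : Finset ℝ),
        B p.1 p.2.1 p.2.2) := measure_mono_ae hcover
    _ ≤ ∑ p ∈ Finset.Icc 1 n ×ˢ (Finset.univ : Finset (Fin K)) ×ˢ ({1, -1} : Finset ℝ),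
        P (B p.1 p.2.1 p.2.2) := measure_biUnion_finset_le _ _
    _ ≤ ∑ p ∈ Finset.Icc 1 n ×ˢ (Finset.univ : Finset (Fin K)) ×ˢ ({1, -1} : Finset ℝ),
        ENNReal.ofReal (Real.exp (-(2 * Real.log ((K : ℝ) ^ 2 * n)))) := by
        refine Finset.sum_le_sum fun p hp => ?_
        simp only [Finset.mem_product, Finset.mem_Icc, Finset.mem_insert,
          Finset.mem_singleton] at hp
        refine measure_pair_deviation_le hK hn hA hY hp.1.1 p.2.1 a ?_
        rcases hp.2.2 with h | h <;> rw [h] <;> norm_num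
    _ = ENNReal.ofReal ((n * (K * 2) : ℕ) * (1 / ((K : ℝ) ^ 2 * n) ^ 2)) := by
        have h2 : ({1, -1} : Finset ℝ).card = 2 := Finset.card_pair (by norm_num)
        rw [Finset.sum_const, Finset.card_product, Finset.card_product, h2, Nat.card_Icc,
          Finset.card_univ, Fintype.card_fin, Nat.add_sub_cancel, hexp,
          ENNReal.ofReal_mul (Nat.cast_nonneg _), ENNReal.ofReal_natCast, nsmul_eq_mul]
    _ ≤ ENNReal.ofReal (1 / n) := by
        refine ENNReal.ofReal_le_ofReal ?_
        push_cast
        rw [mul_one_div, div_le_div_iff₀ (by positivity) (by positivity)]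
        have h3 : (2 : ℝ) ≤ K ^ 3 := by
          calc (2 : ℝ) ≤ 2 ^ 3 := by norm_num
            _ ≤ _ := by gcongr
        calc (n : ℝ) * (K * 2) * n = n ^ 2 * K * 2 := by ring
          _ ≤ n ^ 2 * K * K ^ 3 := by gcongr
          _ = _ := by ring

end

/-! ### The regret decomposition -/

section

variable {K n : ℕ}

theorem sum_ite_eq_playCount (A : ℕ → Fin K) (i : Fin K) (n : ℕ) :
    ∑ t ∈ Finset.Icc 1 n, (if A t = i then (1 : ℝ) else 0) = playCount A i n := by
  unfold playCount; rw [Finset.sum_boole]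

theorem sum_playCount (A : ℕ → Fin K) (n : ℕ) : ∑ i, (playCount A i n : ℝ) = n := by
  simp only [← sum_ite_eq_playCount]
  rw [Finset.sum_comm]
  simp

variable {Ω : Type*} [m0 : MeasurableSpace Ω] {P : Measure Ω} [IsProbabilityMeasure P]

theorem integrable_playCount {A : ℕ → Ω → Fin K} (hA : ∀ t ∈ Finset.Icc 1 n, Measurable (A t))
    (i : Fin K) : Integrable (fun ω => (playCount (fun s => A s ω) i n : ℝ)) P := by
  simp only [← sum_ite_eq_playCount]
  refine integrable_finsetSum _ fun t ht => ?_
  refine Integrable.of_bound (C := 1) (Measurable.aestronglyMeasurable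
    (Measurable.ite (hA t ht (measurableSet_singleton i)) measurable_const measurable_const))
    (ae_of_all _ fun ω => ?_)
  split_ifs <;> simp

/-- The expected reward of the arm pulled at time `t`, which is chosen independently of the rewards
at time `t`. -/
theorem integral_reward_eq [NeZero K] (hn : 1 ≤ n) {ν : Fin K → Measure ℝ}
    (hν : ∀ i, Integrable (fun x : ℝ => x) (ν i)) {Y : ℕ → Ω → ℝ} {A : ℕ → Ω → Fin K}
    {X : ℕ → Fin K → Ω → ℝ} (hA : ∀ t ω, A t ω = elimArm n (fun s => Y s ω) t)
    (hX : IsRealReward P n ν A Y X) (hY : ∀ t ∈ Finset.Icc 1 n, Measurable (Y t)) {t : ℕ}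
    (ht : t ∈ Finset.Icc 1 n) :
    (∀ i, Integrable (X t i) P) ∧ (∀ i, ∫ ω, X t i ω ∂P = armMean ν i) ∧
    Integrable (fun ω => X t (A t ω) ω) P ∧
      ∫ ω, X t (A t ω) ω ∂P = ∑ i, armMean ν i * ∫ ω, (if A t ω = i then (1 : ℝ) else 0) ∂P := by
  obtain ⟨h1, h2⟩ := Finset.mem_Icc.1 ht
  have hAm : Measurable[history A Y (t - 1)] (A t) := by
    rw [show A t = fun ω => elimArm n (fun s => Y s ω) t from funext (hA t)]
    exact measurable_elimArm hn A Y h1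
  have hle := history_le hn hA hY (show t - 1 ≤ n by omega)
  have hXi : ∀ i, Integrable (X t i) P := by
    intro i
    have h := hν i
    rw [← hX.law t ht i] at h
    exact h.comp_measurable (hX.measurable t ht i)
  have hmean : ∀ i, ∫ ω, X t i ω ∂P = armMean ν i := by
    intro i
    unfold armMean
    rw [← hX.law t ht i]
    exact (integral_map (hX.measurable t ht i).aemeasurable
      measurable_id.aestronglyMeasurable).symm
  have hφ : ∀ i, Measurable[history A Y (t - 1)] fun ω => if A t ω = i then (1 : ℝ) else 0 :=
    fun i => Measurable.ite (hAm (measurableSet_singleton i))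
      (@measurable_const _ _ _ (history A Y (t - 1)) _)
      (@measurable_const _ _ _ (history A Y (t - 1)) _)
  have hφi : ∀ i, Integrable (fun ω => if A t ω = i then (1 : ℝ) else 0) P := fun i =>
    Integrable.of_bound (C := 1) ((hφ i).mono hle le_rfl).aestronglyMeasurable
      (ae_of_all _ fun ω => by split_ifs <;> simp)
  have hindep : ∀ i, IndepFun (X t i) (fun ω => if A t ω = i then (1 : ℝ) else 0) P := fun i =>
    indep_of_indep_of_le_right (hX.indep t ht i) (hφ i).comap_le
  have hdec : (fun ω => X t (A t ω) ω) =
      fun ω => ∑ i, X t i ω * (if A t ω = i then (1 : ℝ) else 0) := by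
    funext ω
    simp
  have hprod : ∀ i, Integrable (fun ω => X t i ω * (if A t ω = i then (1 : ℝ) else 0)) P :=
    fun i => (hindep i).integrable_mul (hXi i) (hφi i)
  refine ⟨hXi, hmean, ?_, ?_⟩
  · rw [hdec]
    exact integrable_finsetSum _ fun i _ => hprod i
  · rw [hdec, integral_finsetSum _ fun i _ => hprod i]
    refine Finset.sum_congr rfl fun i _ => ?_
    rw [← hmean i]
    exact (hindep i).integral_fun_mul_eq_mul_integral (hXi i).aestronglyMeasurable
      (hφi i).aestronglyMeasurable

theorem regret_eq_sum_gap_mul [NeZero K] (hn : 1 ≤ n) {ν : Fin K → Measure ℝ}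
    (hν : ∀ i, Integrable (fun x : ℝ => x) (ν i)) {Y : ℕ → Ω → ℝ} {A : ℕ → Ω → Fin K}
    {X : ℕ → Fin K → Ω → ℝ} (hA : ∀ t ω, A t ω = elimArm n (fun s => Y s ω) t)
    (hX : IsRealReward P n ν A Y X) (hY : ∀ t ∈ Finset.Icc 1 n, Measurable (Y t)) :
    regret P n A X = ∑ i with 0 < gap (armMean ν) i,
      gap (armMean ν) i * ∫ ω, (playCount (fun s => A s ω) i n : ℝ) ∂P := by
  have hAm := measurable_arm hn hA hY
  have hT : ∀ i, Integrable (fun ω => (playCount (fun s => A s ω) i n : ℝ)) P := fun i =>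
    integrable_playCount hAm i
  set p : Fin K → ℝ := fun i => ∫ ω, (playCount (fun s => A s ω) i n : ℝ) ∂P with hp
  have hpt : ∀ i, p i = ∑ t ∈ Finset.Icc 1 n, ∫ ω, (if A t ω = i then (1 : ℝ) else 0) ∂P := by
    intro i
    rw [hp]
    simp only [← sum_ite_eq_playCount]
    refine integral_finsetSum _ fun t ht => Integrable.of_bound (C := 1)
      (Measurable.aestronglyMeasurable (Measurable.ite (hAm t ht (measurableSet_singleton i))
        measurable_const measurable_const)) (ae_of_all _ fun ω => by split_ifs <;> simp)
  have hpn : ∑ i, p i = n := by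
    rw [hp, ← integral_finsetSum _ fun i _ => hT i]
    simp [sum_playCount]
  have hj : ∀ j, ∫ ω, ∑ t ∈ Finset.Icc 1 n, (X t j ω - X t (A t ω) ω) ∂P =
      n * armMean ν j - ∑ i, armMean ν i * p i := by
    intro j
    have h := fun t ht => integral_reward_eq (P := P) hn hν hA hX hY (t := t) ht
    have hint : ∀ t ∈ Finset.Icc 1 n, Integrable (fun ω => X t j ω - X t (A t ω) ω) P :=
      fun t ht => ((h t ht).1 j).sub (h t ht).2.2.1
    rw [integral_finsetSum _ hint]
    rw [Finset.sum_congr rfl fun t ht => by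
      rw [integral_sub ((h t ht).1 j) (h t ht).2.2.1, (h t ht).2.1 j, (h t ht).2.2.2],
      Finset.sum_sub_distrib, Finset.sum_comm]
    congr 1
    · simp
    · refine Finset.sum_congr rfl fun i _ => ?_
      rw [hpt, Finset.mul_sum]
  unfold regret
  simp only [hj]
  have hsup : ⨆ j, ((n : ℝ) * armMean ν j - ∑ i, armMean ν i * p i) =
      n * (⨆ j, armMean ν j) - ∑ i, armMean ν i * p i := by
    obtain ⟨a, ha⟩ := exists_eq_ciSup_of_finite (f := armMean ν)
    refine le_antisymm (ciSup_le fun j => ?_) ?_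
    · have := le_ciSup (Set.finite_range (armMean ν)).bddAbove j
      gcongr
    · rw [← ha]
      exact le_ciSup (f := fun j => (n : ℝ) * armMean ν j - ∑ i, armMean ν i * p i)
        (Set.finite_range _).bddAbove a
  have hge : ∀ i, 0 ≤ gap (armMean ν) i := fun i =>
    sub_nonneg.2 (le_ciSup (Set.finite_range (armMean ν)).bddAbove i)
  rw [hsup, ← hpn, Finset.sum_mul, ← Finset.sum_sub_distrib, Finset.sum_filter]
  refine Finset.sum_congr rfl fun i _ => ?_
  split_ifs with h
  · unfold gap; ring
  · have h0 : gap (armMean ν) i = 0 := le_antisymm (not_lt.1 h) (hge i)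
    unfold gap at h0
    rw [mul_comm, ← sub_mul, h0, zero_mul]

end

/-! ### From pull counts to regret bounds -/

section

variable {K n : ℕ} {Ω : Type*} [m0 : MeasurableSpace Ω] {P : Measure Ω} [IsProbabilityMeasure P]

theorem integral_playCount_le {A : ℕ → Ω → Fin K} (hn : 1 ≤ n)
    (hA : ∀ t ∈ Finset.Icc 1 n, Measurable (A t)) {B : Set Ω}
    (hB : P B ≤ ENNReal.ofReal (1 / n)) {i : Fin K} {q : ℝ} (hq0 : 0 ≤ q)
    (hq : ∀ ω, ω ∉ B → (playCount (fun s => A s ω) i n : ℝ) ≤ q) :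
    ∫ ω, (playCount (fun s => A s ω) i n : ℝ) ∂P ≤ 1 + q := by
  have hn' : (0 : ℝ) < n := by exact_mod_cast hn
  -- `B` need not be measurable
  set B' := toMeasurable P B
  have hB'm : MeasurableSet B' := measurableSet_toMeasurable P B
  have hB' : P.real B' ≤ 1 / n := by
    rw [measureReal_def, measure_toMeasurable]
    exact ENNReal.toReal_le_of_le_ofReal (by positivity) hB
  calc ∫ ω, (playCount (fun s => A s ω) i n : ℝ) ∂P
      ≤ ∫ ω, (B'.indicator (fun _ => (n : ℝ)) ω + q) ∂P := by
        refine integral_mono (integrable_playCount hA i)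
          (((integrable_const _).indicator hB'm).add (integrable_const q)) fun ω => ?_
        by_cases h : ω ∈ B'
        · have : (playCount (fun s => A s ω) i n : ℝ) ≤ n := by
            exact_mod_cast playCount_le (fun s => A s ω) i n
          simp only [Set.indicator_of_mem h]
          linarith
        · have := hq ω fun h' => h (subset_toMeasurable P B h')
          simpa only [Set.indicator_of_notMem h, zero_add] using this
    _ = P.real B' * n + q := by
        rw [integral_add ((integrable_const _).indicator hB'm) (integrable_const q),
          integral_indicator_const _ hB'm]
        simp
    _ ≤ 1 / n * n + q := by gcongr
    _ = 1 + q := by rw [one_div_mul_cancel hn'.ne']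

/-- A gap-free bound from the bounds `1 + l / (Δ_i w)²` on the expected numbers of pulls: the arms
of gap at most `δ = √(K l / (n w²))` contribute at most `n δ`, the others at most `K + K l / (δ w²)`
together. -/
theorem sum_mul_le_gapFree {g p : Fin K → ℝ} (hg1 : ∀ i, g i ≤ 1)
    (hp0 : ∀ i, 0 ≤ p i) (hpn : ∑ i, p i = n) {w l : ℝ} (hw : 0 < w) (hl : 0 ≤ l) (hn : 1 ≤ n)
    (hp : ∀ i, 0 < g i → p i ≤ 1 + l / (g i * w) ^ 2) :
    ∑ i with 0 < g i, g i * p i ≤ K + 2 * Real.sqrt (n * K * l / w ^ 2) := by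
  have hn' : (0 : ℝ) < n := by exact_mod_cast hn
  set s := Real.sqrt (n * K * l / w ^ 2) with hs
  have hs0 : 0 ≤ s := Real.sqrt_nonneg _
  have hsq : s ^ 2 = n * K * l / w ^ 2 := Real.sq_sqrt (by positivity)
  have hKl : K * (l / w ^ 2) = s * (s / n) := by
    field_simp
    rw [hsq]
    field_simp
  have hterm : ∀ i, 0 < g i → g i * p i ≤ s / n * p i + (1 + s / K) := by
    intro i hi
    have hK : (0 : ℝ) < K := by exact_mod_cast i.pos
    rcases le_or_gt (g i) (s / n) with h | h
    · have := mul_le_mul_of_nonneg_right h (hp0 i)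
      have : 0 ≤ s / K := by positivity
      linarith
    · have h1 : g i * (l / (g i * w) ^ 2) ≤ s / K := by
        rw [show g i * (l / (g i * w) ^ 2) = l / w ^ 2 / g i by field_simp, div_le_iff₀ hi,
          div_mul_eq_mul_div, le_div_iff₀ hK, mul_comm _ (K : ℝ), hKl]
        gcongr
      have h2 := mul_le_mul_of_nonneg_left (hp i hi) hi.le
      have h3 : 0 ≤ s / n * p i := mul_nonneg (by positivity) (hp0 i)
      linarith [hg1 i]
  calc ∑ i with 0 < g i, g i * p i
      ≤ ∑ i with 0 < g i, (s / n * p i + (1 + s / K)) :=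
        Finset.sum_le_sum fun i hi => hterm i (Finset.mem_filter.1 hi).2
    _ ≤ ∑ i, (s / n * p i + (1 + s / K)) :=
        Finset.sum_le_sum_of_subset_of_nonneg (Finset.filter_subset _ _) fun i _ _ =>
          add_nonneg (mul_nonneg (by positivity) (hp0 i)) (by positivity)
    _ = s + K * (1 + s / K) := by
        rw [Finset.sum_add_distrib, ← Finset.mul_sum, hpn, div_mul_cancel₀ _ hn'.ne',
          Finset.sum_const, Finset.card_univ, Fintype.card_fin, nsmul_eq_mul]
    _ ≤ K + 2 * s := by
        rcases Nat.eq_zero_or_pos K with rfl | hK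
        · simp; linarith
        · have : (K : ℝ) ≠ 0 := by positivity
          rw [mul_add, mul_div_cancel₀ _ this]
          linarith

end

section

variable {K n : ℕ}

theorem gap_le_one [NeZero K] {μ : Fin K → ℝ} (hμ : ∀ i, μ i ∈ Set.Icc (0 : ℝ) 1) (i : Fin K) :
    gap μ i ≤ 1 := by
  have h : ⨆ j, μ j ≤ 1 := ciSup_le fun j => (hμ j).2
  unfold gap
  linarith [(hμ i).1]

theorem two_le_of_gap_pos {μ : Fin K → ℝ} {i : Fin K} (hi : 0 < gap μ i) : 2 ≤ K := by
  by_contra! hK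
  have hs : Subsingleton (Fin K) := Fin.subsingleton_iff_le_one.2 (by omega)
  have : Nonempty (Fin K) := ⟨i⟩
  obtain ⟨a, ha⟩ := exists_eq_ciSup_of_finite (f := μ)
  unfold gap at hi
  rw [← ha, Subsingleton.elim a i, sub_self] at hi
  exact lt_irrefl _ hi

theorem gap_mul_fMin_lastRound_le [NeZero K] (hn : 1 ≤ n) {μ : Fin K → ℝ} {f : ℝ → ℝ}
    {T0 : Fin K → ℝ} (hf : ∀ x ∈ Set.Ioc (0 : ℝ) 1, f x ∈ Set.Ioc (0 : ℝ) 1)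
    (hf_mono : MonotoneOn f (Set.Ioc (0 : ℝ) 1)) (hT0 : ∀ i, 1 ≤ T0 i) {i : Fin K}
    (hi : 0 < gap μ i) (hi1 : gap μ i ≤ 1) :
    i ∈ idealSet n μ f T0 (lastRound n μ f T0 i - 1) ∧
    gap μ i * fMin n μ f T0 i (lastRound n μ f T0 i - 1) ≤
      2 * (1 / 2 : ℝ) ^ (lastRound n μ f T0 i - 1) := by
  obtain ⟨h1, -, h2⟩ := lastRound_spec hn hf hf_mono hT0 hi hi1
  have h3 := h2 _ (by omega) le_rfl
  have h4 : lastRound n μ f T0 i - 1 + 1 = lastRound n μ f T0 i := by omega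
  exact (mem_idealSet_succ n μ f T0 (by omega) i).1 (h4.symm ▸ h3)

theorem instanceBound_anti (hn : 1 ≤ n) {μ : Fin K → ℝ} {w w' : Fin K → ℝ}
    (hw' : ∀ i, 0 < gap μ i → 0 < w' i) (hw : ∀ i, 0 < gap μ i → w' i ≤ w i) :
    instanceBound n μ w ≤ instanceBound n μ w' := by
  refine Finset.sum_le_sum fun i hi => ?_
  have hi := (Finset.mem_filter.1 hi).2
  have hl := logFactor_nonneg (n := n) (show 1 ≤ K by have := two_le_of_gap_pos hi; omega) hn
  have h1 := hw' i hi
  have h2 := hw i hi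
  gcongr

theorem iInf_div_mem_and_le [NeZero K] {T0 : Fin K → ℝ} (hT0 : ∀ i, 1 ≤ T0 i) (i : Fin K) :
    (⨅ i, T0 i) / (totalInit T0 + (K : ℝ) - 1) ∈ Set.Ioc (0 : ℝ) 1 ∧
    (⨅ i, T0 i) / (totalInit T0 + (K : ℝ) - 1) ≤
      min (T0 i / (totalInit T0 + ((i : ℕ) : ℝ))) (1 / (K : ℝ)) := by
  have hK : (1 : ℝ) ≤ K := by exact_mod_cast Nat.pos_of_ne_zero (NeZero.ne K)
  have hle : ∀ j, ⨅ i, T0 i ≤ T0 j := fun j => ciInf_le (Set.finite_range T0).bddBelow j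
  have h1 : 1 ≤ ⨅ i, T0 i := le_ciInf hT0
  have hsum : K * (⨅ i, T0 i) ≤ totalInit T0 := by
    have := Finset.sum_le_sum fun j (_ : j ∈ Finset.univ) => hle j
    simpa [totalInit] using this
  have hi : ((i : ℕ) : ℝ) ≤ (K : ℝ) - 1 := by
    have : ((i : ℕ) : ℝ) + 1 ≤ K := by exact_mod_cast i.2
    linarith
  have hi0 : (0 : ℝ) ≤ (i : ℕ) := Nat.cast_nonneg _
  have ht : 1 ≤ totalInit T0 := (hT0 i).trans (le_totalInit hT0 i)
  have hpos : 0 < (⨅ i, T0 i) / (totalInit T0 + (K : ℝ) - 1) :=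
    div_pos (by linarith) (by linarith)
  have hmin : (⨅ i, T0 i) / (totalInit T0 + (K : ℝ) - 1) ≤
      min (T0 i / (totalInit T0 + ((i : ℕ) : ℝ))) (1 / (K : ℝ)) := by
    refine le_min (div_le_div₀ (by linarith [hT0 i]) (hle i) (by linarith) (by linarith)) ?_
    rw [div_le_div_iff₀ (by linarith) (by linarith)]
    linarith
  exact ⟨⟨hpos, hmin.trans (min_mem_Ioc hT0 i).2⟩, hmin⟩

variable {Ω : Type*} [m0 : MeasurableSpace Ω] {P : Measure Ω} [IsProbabilityMeasure P]

/-- The bound on the expected number of pulls of a suboptimal arm. Any `w` may serve for which the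
threshold of round `u_i - 1` is not exceeded. -/
theorem integral_playCount_elim_le [NeZero K] (hn : 1 ≤ n) {μ : Fin K → ℝ} {f : ℝ → ℝ}
    {L : ℝ≥0} {T0 : Fin K → ℝ} (hμ : ∀ i, μ i ∈ Set.Icc (0 : ℝ) 1) (hT0 : ∀ i, 1 ≤ T0 i)
    (hf : ∀ x ∈ Set.Ioc (0 : ℝ) 1, f x ∈ Set.Ioc (0 : ℝ) 1)
    (hf_mono : MonotoneOn f (Set.Ioc (0 : ℝ) 1))
    (hf_lip : LipschitzOnWith L f (Set.Ioc (0 : ℝ) 1)) {Y : ℕ → Ω → ℝ} {A : ℕ → Ω → Fin K}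
    (hA : ∀ t ω, A t ω = elimArm n (fun s => Y s ω) t) (hY : IsBiasedFeedback P n μ f T0 A Y)
    (hlarge : (⨆ i, μ i) * (L : ℝ) / 2 ^ 5 *
          (1 + max
            ((1 + ((⨆ i, T0 i) - (⨅ i, T0 i)) / (K : ℝ)) *
              Real.log (1 + 2 ^ 8 * Real.log (12 / Real.pi ^ 2 * (K : ℝ) ^ 2 * (n : ℝ))))
            ((1 + ((⨆ i, T0 i) - (⨅ i, T0 i))) * Real.log 13))
        ≤ Real.log ((n : ℝ) * (K : ℝ)))
    {i : Fin K} (hi : 0 < gap μ i) {w : ℝ} (hw : 0 < w)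
    (hwu : gap μ i * w ≤ 2 * (1 / 2 : ℝ) ^ (lastRound n μ f T0 i - 1)) :
    ∫ ω, (playCount (fun s => A s ω) i n : ℝ) ∂P ≤ 1 + logFactor K n / (gap μ i * w) ^ 2 := by
  have hK := two_le_of_gap_pos hi
  have hl := logFactor_nonneg (n := n) (show 1 ≤ K by omega) hn
  obtain ⟨hu2, hu, -⟩ := lastRound_spec hn hf hf_mono hT0 hi (gap_le_one hμ i)
  set u := lastRound n μ f T0 i
  obtain ⟨a, ha⟩ := exists_eq_ciSup_of_finite (f := μ)
  have hgap : ∀ j, gap μ j = μ a - μ j := fun j => by rw [ha]; rfl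
  have hbest : ∀ j, μ j ≤ μ a := fun j => by
    rw [ha]; exact le_ciSup (Set.finite_range μ).bddAbove j
  rw [← ha] at hlarge
  have hD : ∀ i j, T0 j - T0 i ≤ (⨆ i, T0 i) - (⨅ i, T0 i) := fun i j =>
    sub_le_sub (le_ciSup (Set.finite_range T0).bddAbove j)
      (ciInf_le (Set.finite_range T0).bddBelow i)
  have hD0 : 0 ≤ (⨆ i, T0 i) - (⨅ i, T0 i) := by simpa using hD i i
  have hAm := measurable_arm hn hA hY.measurable
  have h := integral_playCount_le hn hAm (measure_not_noiseSmall_le hK hn hA hY a) (i := i)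
    (q := 4 ^ u / 16 * logFactor K n) (by positivity) fun ω hω => by
      have hω' : NoiseSmall n μ f T0 a fun s => Y s ω := not_not.1 hω
      simp only [hA]
      exact playCount_le_of_noiseSmall hK hn hT0 hf hf_mono hf_lip hD hD0 hbest (hμ a).1 hgap
        hlarge hω' hu
  refine h.trans (add_le_add le_rfl ?_)
  have hgw : 0 < gap μ i * w := mul_pos hi hw
  have h2 : gap μ i * w * 2 ^ u ≤ 4 := by
    obtain ⟨k, hk⟩ : ∃ k, u = k + 1 := ⟨u - 1, by omega⟩
    rw [hk, Nat.add_sub_cancel] at hwu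
    calc gap μ i * w * 2 ^ u ≤ 2 * (1 / 2 : ℝ) ^ k * 2 ^ u := by gcongr
      _ = 4 * ((1 / 2 : ℝ) * 2) ^ k := by rw [hk, mul_pow]; ring
      _ = 4 := by norm_num
  rw [div_mul_eq_mul_div, div_le_div_iff₀ (by norm_num) (by positivity)]
  calc (4 : ℝ) ^ u * logFactor K n * (gap μ i * w) ^ 2
      = (gap μ i * w * 2 ^ u) ^ 2 * logFactor K n := by
        rw [mul_pow _ (2 ^ u), ← pow_mul, mul_comm u 2, pow_mul]; norm_num; ring
    _ ≤ 4 ^ 2 * logFactor K n := by gcongr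
    _ = _ := by ring

theorem sum_gap_mul_le_instanceBound {μ : Fin K → ℝ} {p w : Fin K → ℝ}
    (hp : ∀ i, 0 < gap μ i → p i ≤ 1 + logFactor K n / (gap μ i * w i) ^ 2) :
    ∑ i with 0 < gap μ i, gap μ i * p i ≤ instanceBound n μ w := by
  refine Finset.sum_le_sum fun i hi => ?_
  have hi := (Finset.mem_filter.1 hi).2
  refine (mul_le_mul_of_nonneg_left (hp i hi) hi.le).trans (le_of_eq ?_)
  rw [mul_add, mul_one, mul_pow]
  congr 1
  rcases eq_or_ne (w i) 0 with h | h
  · simp [h]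
  · field_simp

end

end AffinityBandit

end

theorem mainTheorem2 {K n : ℕ} [NeZero K] (hn : 1 ≤ n)
    {Ω : Type*} [MeasurableSpace Ω] (P : Measure Ω) [IsProbabilityMeasure P]
    -- the arms: distributions with finite means in `[0, 1]`
    (ν : Fin K → Measure ℝ)
    (hν : ∀ i, Integrable (fun x : ℝ => x) (ν i))
    (hmean : ∀ i, AffinityBandit.armMean ν i ∈ Set.Icc (0 : ℝ) 1)
    -- the bias model
    (f : ℝ → ℝ) (L : ℝ≥0)
    (hf_range : ∀ x ∈ Set.Ioc (0 : ℝ) 1, f x ∈ Set.Ioc (0 : ℝ) 1)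
    (hf_mono : MonotoneOn f (Set.Ioc (0 : ℝ) 1))
    (hf_lip : LipschitzOnWith L f (Set.Ioc (0 : ℝ) 1))
    (T0 : Fin K → ℝ) (hT0 : ∀ i, 1 ≤ T0 i)
    -- rewards and feedback when the arms are pulled by the elimination algorithm
    (X : ℕ → Fin K → Ω → ℝ) (Y : ℕ → Ω → ℝ) (A : ℕ → Ω → Fin K)
    (hA : ∀ t ω, A t ω = AffinityBandit.elimArm n (fun s => Y s ω) t)
    (hX : AffinityBandit.IsRealReward P n ν A Y X)
    (hY : AffinityBandit.IsBiasedFeedback P n (AffinityBandit.armMean ν) f T0 A Y)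
    -- the time horizon is sufficiently large
    (hlarge :
      (⨆ i, AffinityBandit.armMean ν i) * (L : ℝ) / 2 ^ 5 *
          (1 + max
            ((1 + ((⨆ i, T0 i) - (⨅ i, T0 i)) / (K : ℝ)) *
              Real.log (1 + 2 ^ 8 * Real.log (12 / Real.pi ^ 2 * (K : ℝ) ^ 2 * (n : ℝ))))
            ((1 + ((⨆ i, T0 i) - (⨅ i, T0 i))) * Real.log 13))
        ≤ Real.log ((n : ℝ) * (K : ℝ))) :
    -- `u_i` and `f^min_i(u_i - 1)` are well defined, and the latter is positive
    (∀ i, 0 < AffinityBandit.gap (AffinityBandit.armMean ν) i →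
      2 ≤ AffinityBandit.lastRound n (AffinityBandit.armMean ν) f T0 i ∧
      0 < AffinityBandit.fMin n (AffinityBandit.armMean ν) f T0 i
        (AffinityBandit.lastRound n (AffinityBandit.armMean ν) f T0 i - 1)) ∧
    -- the regret decomposition
    AffinityBandit.regret P n A X =
      ∑ i with 0 < AffinityBandit.gap (AffinityBandit.armMean ν) i,
        AffinityBandit.gap (AffinityBandit.armMean ν) i *
          ∫ ω, (AffinityBandit.playCount (fun s => A s ω) i n : ℝ) ∂P ∧
    -- the instance-dependent bound
    AffinityBandit.regret P n A X ≤
      AffinityBandit.instanceBound n (AffinityBandit.armMean ν) (fun i =>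
        AffinityBandit.fMin n (AffinityBandit.armMean ν) f T0 i
          (AffinityBandit.lastRound n (AffinityBandit.armMean ν) f T0 i - 1)) ∧
    -- the gap-free bound
    AffinityBandit.regret P n A X ≤
      AffinityBandit.gapFreeBound K n
        (f ((⨅ i, T0 i) / (AffinityBandit.totalInit T0 + (K : ℝ) - 1))) ∧
    -- the simplified instance-dependent bounds
    AffinityBandit.regret P n A X ≤
      AffinityBandit.instanceBound n (AffinityBandit.armMean ν) (fun i =>
        f (min (T0 i / (AffinityBandit.totalInit T0 + ((i : ℕ) : ℝ))) (1 / (K : ℝ)))) ∧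
    AffinityBandit.instanceBound n (AffinityBandit.armMean ν) (fun i =>
        f (min (T0 i / (AffinityBandit.totalInit T0 + ((i : ℕ) : ℝ))) (1 / (K : ℝ)))) ≤
      AffinityBandit.instanceBound n (AffinityBandit.armMean ν) (fun _ =>
        f ((⨅ i, T0 i) / (AffinityBandit.totalInit T0 + (K : ℝ) - 1))) ∧
    -- the bounds for moderate initial biases
    ((⨆ i, T0 i) ≤ 2 ^ 7 * Real.log (12 / Real.pi ^ 2 * (K : ℝ) ^ 2 * (n : ℝ)) →
      AffinityBandit.regret P n A X ≤
        AffinityBandit.instanceBound n (AffinityBandit.armMean ν)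
          (fun _ => f (1 / (15 * (K : ℝ)))) ∧
      AffinityBandit.regret P n A X ≤
        AffinityBandit.gapFreeBound K n (f (1 / (15 * (K : ℝ))))) := by
  have hgap_le := AffinityBandit.gap_le_one hmean
  have hw0 : ∀ i, 0 < f (min (T0 i / (AffinityBandit.totalInit T0 + ((i : ℕ) : ℝ)))
      (1 / (K : ℝ))) := fun i => (hf_range _ (AffinityBandit.min_mem_Ioc hT0 i)).1
  have hspec := fun i hi =>
    AffinityBandit.lastRound_spec (μ := AffinityBandit.armMean ν) (f := f) (T0 := T0) (i := i)
      hn hf_range hf_mono hT0 hi (hgap_le i)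
  have hthr := fun i hi => AffinityBandit.gap_mul_fMin_lastRound_le (μ := AffinityBandit.armMean ν)
    (f := f) (T0 := T0) (i := i) hn hf_range hf_mono hT0 hi (hgap_le i)
  have hwle : ∀ i, 0 < AffinityBandit.gap (AffinityBandit.armMean ν) i →
      f (min (T0 i / (AffinityBandit.totalInit T0 + ((i : ℕ) : ℝ))) (1 / (K : ℝ))) ≤
        AffinityBandit.fMin n (AffinityBandit.armMean ν) f T0 i
          (AffinityBandit.lastRound n (AffinityBandit.armMean ν) f T0 i - 1) := fun i hi =>
    AffinityBandit.le_fMin hn hf_mono hT0 (by have := (hspec i hi).1; omega) (hthr i hi).1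
  have hmin : ∀ i, f ((⨅ i, T0 i) / (AffinityBandit.totalInit T0 + (K : ℝ) - 1)) ≤
      f (min (T0 i / (AffinityBandit.totalInit T0 + ((i : ℕ) : ℝ))) (1 / (K : ℝ))) := fun i =>
    hf_mono (AffinityBandit.iInf_div_mem_and_le hT0 i).1 (AffinityBandit.min_mem_Ioc hT0 i)
      (AffinityBandit.iInf_div_mem_and_le hT0 i).2
  have hmin0 : 0 < f ((⨅ i, T0 i) / (AffinityBandit.totalInit T0 + (K : ℝ) - 1)) :=
    (hf_range _ (AffinityBandit.iInf_div_mem_and_le hT0 0).1).1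
  have hreg := AffinityBandit.regret_eq_sum_gap_mul hn hν hA hX hY.measurable
  have hpull : ∀ i, 0 < AffinityBandit.gap (AffinityBandit.armMean ν) i → ∀ w : ℝ, 0 < w →
      AffinityBandit.gap (AffinityBandit.armMean ν) i * w ≤ 2 * (1 / 2 : ℝ) ^
        (AffinityBandit.lastRound n (AffinityBandit.armMean ν) f T0 i - 1) →
      ∫ ω, (AffinityBandit.playCount (fun s => A s ω) i n : ℝ) ∂P ≤
        1 + AffinityBandit.logFactor K n /
          (AffinityBandit.gap (AffinityBandit.armMean ν) i * w) ^ 2 := fun i hi w hw hwu =>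
    AffinityBandit.integral_playCount_elim_le hn hmean hT0 hf_range hf_mono hf_lip hA hY hlarge
      hi hw hwu
  have hAm := AffinityBandit.measurable_arm hn hA hY.measurable
  have hgapFree : ∀ w : ℝ, 0 < w → (∀ i, 0 < AffinityBandit.gap (AffinityBandit.armMean ν) i →
      AffinityBandit.gap (AffinityBandit.armMean ν) i * w ≤ 2 * (1 / 2 : ℝ) ^
        (AffinityBandit.lastRound n (AffinityBandit.armMean ν) f T0 i - 1)) →
      AffinityBandit.regret P n A X ≤ AffinityBandit.gapFreeBound K n w := by
    intro w hw hwu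
    rw [hreg]
    refine AffinityBandit.sum_mul_le_gapFree hgap_le
      (fun i => integral_nonneg fun ω => Nat.cast_nonneg _) ?_ hw
      (AffinityBandit.logFactor_nonneg (Nat.pos_of_ne_zero (NeZero.ne K)) hn) hn
      fun i hi => hpull i hi w hw (hwu i hi)
    rw [← integral_finsetSum _ fun i _ => AffinityBandit.integrable_playCount hAm i]
    simp [AffinityBandit.sum_playCount]
  have hinst : AffinityBandit.regret P n A X ≤
      AffinityBandit.instanceBound n (AffinityBandit.armMean ν) (fun i =>
        AffinityBandit.fMin n (AffinityBandit.armMean ν) f T0 i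
          (AffinityBandit.lastRound n (AffinityBandit.armMean ν) f T0 i - 1)) := by
    rw [hreg]
    exact AffinityBandit.sum_gap_mul_le_instanceBound fun i hi =>
      hpull i hi _ ((hw0 i).trans_le (hwle i hi)) (hthr i hi).2
  refine ⟨fun i hi => ⟨(hspec i hi).1, (hw0 i).trans_le (hwle i hi)⟩, hreg, hinst, ?_, ?_, ?_, ?_⟩
  · exact hgapFree _ hmin0 fun i hi =>
      (mul_le_mul_of_nonneg_left ((hmin i).trans (hwle i hi)) hi.le).trans (hthr i hi).2
  · exact hinst.trans (AffinityBandit.instanceBound_anti hn (fun i _ => hw0 i) hwle)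
  · exact AffinityBandit.instanceBound_anti hn (fun _ _ => hmin0) fun i _ => hmin i
  · intro hmod
    have hK1 : (1 : ℝ) ≤ K := by exact_mod_cast Nat.pos_of_ne_zero (NeZero.ne K)
    have hw := hf_range (1 / (15 * (K : ℝ)))
      ⟨by positivity, (div_le_one (by positivity)).2 (by linarith)⟩
    have hm : ∀ i, T0 i ≤ AffinityBandit.pulls K n 1 := fun i => by
      refine (le_ciSup (Set.finite_range T0).bddAbove i).trans (hmod.trans ?_)
      have := AffinityBandit.schedule_le_pulls K n 1
      unfold AffinityBandit.schedule at this
      simpa using this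
    have hwu : ∀ i, 0 < AffinityBandit.gap (AffinityBandit.armMean ν) i →
        AffinityBandit.gap (AffinityBandit.armMean ν) i * f (1 / (15 * (K : ℝ))) ≤
          2 * (1 / 2 : ℝ) ^
            (AffinityBandit.lastRound n (AffinityBandit.armMean ν) f T0 i - 1) := by
      intro i hi
      rcases eq_or_lt_of_le (hspec i hi).1 with hu | hu
      -- for `u_i = 2` the threshold of round `u_i - 1` is `1`, so nothing is needed of `f`
      · rw [← hu]
        have := mul_le_mul (hgap_le i) hw.2 hw.1.le zero_le_one
        norm_num at this ⊢
        exact this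
      · exact (mul_le_mul_of_nonneg_left (AffinityBandit.le_fMin_of_two_le hn hf_mono hT0 hm
          (by omega) (hthr i hi).1) hi.le).trans (hthr i hi).2
    refine ⟨?_, hgapFree _ hw.1 hwu⟩
    rw [hreg]
    exact AffinityBandit.sum_gap_mul_le_instanceBound fun i hi => hpull i hi _ hw.1 (hwu i hi)
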